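/- Identify the plane with $\mathbb{C}$. For $\Lambda\subset\mathbb{C}$ let $\mathbb{K}_\Lambda=\mathbb{Q}\big((\Lambda-\Lambda)\cup\overline{(\Lambda-\Lambda)}\big)$ and $\mathbb{k}_\Lambda=\mathbb{K}_\Lambda\cap\mathbb{R}$, and for $n\ge 1$ let $\mathbb{k}_n=\mathbb{Q}(\zeta_n+\bar\zeta_n)$ with $\zeta_n=e^{2\pi i/n}$. The set $\Lambda$ is called non-degenerate if $\mathbb{K}_\Lambda\not\subset\mathbb{R}$; it has property (Alg) if $[\mathbb{K}_\Lambda:\mathbb{Q}]<\infty$, and property (Aff) if for every finite $F\subset\mathbb{K}_\Lambda$ there is a non-singular affine transformation $\Psi$ of the (real) plane with $\Psi(F)\subset\Lambda$. A direction is a unit vector; it is a $\Lambda$-direction if it is parallel to a non-zero element of $\Lambda-\Lambda$. A polygon is in $\Lambda$ if all its vertices are in $\Lambda$. An affinely regular polygon is the image of a regular (convex, non-degenerate) polygon under a non-singular affine transformation of the plane. For a finite set $U$ of pairwise non-parallel directions, a $U$-polygon is a non-degenerate convex polygon $P$ such that for every vertex $v$ of $P$ and every $u\in U$ the line through $v$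 in direction $u$ contains another vertex of $P$. A $U$-polygon $P$ is of class $c$ (with respect to $U$) if $c$ is the largest integer with $0<c\le\operatorname{card}(U)$ for which $P$ has $c$ consecutive edges all of which are parallel to elements of $U$. **Theorem.** Let $\Lambda\subset\mathbb{C}$ be non-degenerate with property (Aff). Then for every even $m\ge 8$ the following are equivalent: (i) there are a finite set $U$ of pairwise non-parallel directions, an integer $c\ge 4$, and a $U$-polygon of class $c$ in $\Lambda$ with $m$ edges; (ii) there are a finite set $U$ of pairwise non-parallel $\Lambda$-directions, an integer $c\ge 4$, and an affinely regular $U$-polygon of class $c$ with $m$ edges (whose vertices need not lie in $\Lambda$); (iii) $\mathbb{k}_{m/2}\subset\mathbb{k}_\Lambda$; (iv) there is an affinely regular polygon in $\Lambda$ with $\operatorname{lcm}(m/2,2)$ edges. If $\Lambda$ moreover has property (Alg), then (i)–(iv) hold for only finitely many even $m\ge 8$. -/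

import Mathlib

open scoped Pointwise ComplexConjugate

noncomputable section

namespace UPoly

/-! ### Fields attached to a planar set (the plane is `ℂ`) -/

/-- The field `ℚ((Λ - Λ) ∪ conj (Λ - Λ))`. -/
def fieldK (Λ : Set ℂ) : IntermediateField ℚ ℂ :=
  IntermediateField.adjoin ℚ ((Λ - Λ) ∪ conj '' (Λ - Λ))

/-- `ℝ`, as an intermediate field of `ℂ/ℚ`. -/
def realField : IntermediateField ℚ ℂ :=
  (Complex.ofRealAm.restrictScalars ℚ).fieldRange

/-- The maximal real subfield `fieldK Λ ∩ ℝ`. -/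
def fieldk (Λ : Set ℂ) : IntermediateField ℚ ℂ := fieldK Λ ⊓ realField

/-- `ζ_n = exp (2πi/n)`. -/
def zeta (n : ℕ) : ℂ := Complex.exp (2 * Real.pi * Complex.I / n)

/-- The field `ℚ(ζ_n + conj ζ_n)`. -/
def cycloReal (n : ℕ) : IntermediateField ℚ ℂ :=
  IntermediateField.adjoin ℚ {zeta n + conj (zeta n)}

/-- `Λ` is degenerate if `fieldK Λ` is a subfield of `ℝ`. -/
def Degenerate (Λ : Set ℂ) : Prop := fieldK Λ ≤ realField

/-- Property (Alg). -/
def PropAlg (Λ : Set ℂ) : Prop := FiniteDimensional ℚ (fieldK Λ)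

/-- Property (Aff). A non-singular affine transformation of the plane is an affine
self-equivalence over `ℝ`. -/
def PropAff (Λ : Set ℂ) : Prop :=
  ∀ F : Set ℂ, F.Finite → F ⊆ (fieldK Λ : Set ℂ) → ∃ Ψ : ℂ ≃ᵃ[ℝ] ℂ, Ψ '' F ⊆ Λ

/-! ### Directions -/

/-- Parallelism of non-zero vectors. -/
def Parallel (z w : ℂ) : Prop := ∃ t : ℝ, t ≠ 0 ∧ w = t • z

/-- `u` is a unit vector parallel to a non-zero element of `Λ - Λ`. -/
def IsLambdaDirection (Λ : Set ℂ) (u : ℂ) : Prop :=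
  ‖u‖ = 1 ∧ ∃ z ∈ Λ - Λ, z ≠ 0 ∧ Parallel u z

/-- A finite set of pairwise non-parallel directions. -/
def IsDirectionSet (U : Finset ℂ) : Prop :=
  (∀ u ∈ U, ‖u‖ = 1) ∧ ∀ u ∈ U, ∀ v ∈ U, u ≠ v → ¬ Parallel u v

/-! ### Polygons

`Polygon ℂ n` lists `n` vertices; the successor of the index `i` is `finRotate n i`. -/

/-- The vector along the `i`-th edge. -/
def edgeVec {n : ℕ} (P : Polygon ℂ n) (i : Fin n) : ℂ := P (finRotate n i) - P i

/-- The vertices are the `n ≥ 3` vertices of a non-degenerate convex polygon, listed in cyclic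
order along its boundary (in either orientation): every vertex not on the `i`-th edge lies
strictly to the left of that edge, for every `i` (counterclockwise listing), or strictly to the
right of it, for every `i` (clockwise listing). For complex numbers `a`, `b` the number
`(conj a * b).im` is the determinant of the pair `(a, b)`. -/
def IsConvexPolygon {n : ℕ} (P : Polygon ℂ n) : Prop :=
  3 ≤ n ∧
    ((∀ i j : Fin n, j ≠ i → j ≠ finRotate n i → 0 < (conj (edgeVec P i) * (P j - P i)).im) ∨
     (∀ i j : Fin n, j ≠ i → j ≠ finRotate n i → (conj (edgeVec P i) * (P j - P i)).im < 0))

/-- All vertices belong to `S`. -/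
def VerticesIn {n : ℕ} (P : Polygon ℂ n) (S : Set ℂ) : Prop := ∀ i, P i ∈ S

/-- A regular `n`-gon, `n ≥ 3`: its vertices, in cyclic order, are `c + r ζ_n ^ k` for a centre
`c` and some `r ≠ 0` (the modulus of `r` is the circumradius). -/
def IsRegularPolygon {n : ℕ} (P : Polygon ℂ n) : Prop :=
  3 ≤ n ∧ ∃ c r : ℂ, r ≠ 0 ∧ ∀ k : Fin n, P k = c + r * zeta n ^ (k : ℕ)

/-- A non-singular affine image of a regular polygon. -/
def IsAffinelyRegular {n : ℕ} (P : Polygon ℂ n) : Prop :=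
  ∃ (Q : Polygon ℂ n) (Ψ : ℂ ≃ᵃ[ℝ] ℂ), IsRegularPolygon Q ∧ ∀ k, P k = Ψ (Q k)

/-- `P` is a `U`-polygon: for every vertex `v` and `u ∈ U`, the line through `v` in
direction `u` meets another vertex. -/
def IsUPolygon {n : ℕ} (U : Finset ℂ) (P : Polygon ℂ n) : Prop :=
  IsDirectionSet U ∧ IsConvexPolygon P ∧
    ∀ u ∈ U, ∀ i, ∃ j, P j ≠ P i ∧ ∃ t : ℝ, P j = P i + t • u

/-- The `k` consecutive edges of `P` that start with the `i`-th one all have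
directions belonging to `U`. -/
def RunInU {n : ℕ} (U : Finset ℂ) (P : Polygon ℂ n) (i : Fin n) (k : ℕ) : Prop :=
  ∀ j < k, ∃ u ∈ U, Parallel u (edgeVec P ((finRotate n)^[j] i))

/-- The `U`-polygon `P` is of class `c` with respect to `U`: among the numbers
`0 < k ≤ card U`, `c` is the largest for which there are `k` consecutive edges of `P` with
directions in `U`. (The bound `k ≤ card U` matters only if all edges have directions in `U`.) -/
def IsOfClass {n : ℕ} (U : Finset ℂ) (P : Polygon ℂ n) (c : ℕ) : Prop :=
  IsUPolygon U P ∧ IsGreatest {k : ℕ | 0 < k ∧ k ≤ U.card ∧ ∃ i, RunInU U P i k} c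

/-! ### The assertions -/

/-- There is a `U`-polygon of class `c ≥ 4` in `Λ` with `m` edges. -/
def HasUPolygonIn (Λ : Set ℂ) (m : ℕ) : Prop :=
  ∃ (U : Finset ℂ) (P : Polygon ℂ m) (c : ℕ), 4 ≤ c ∧ IsOfClass U P c ∧ VerticesIn P Λ

/-- There is an affinely regular `U`-polygon of class `c ≥ 4` with `m` edges for a set `U` of
`Λ`-directions. -/
def HasAffinelyRegularUPolygon (Λ : Set ℂ) (m : ℕ) : Prop :=
  ∃ (U : Finset ℂ) (P : Polygon ℂ m) (c : ℕ), (∀ u ∈ U, IsLambdaDirection Λ u) ∧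
    4 ≤ c ∧ IsOfClass U P c ∧ IsAffinelyRegular P

/-- There is an affinely regular polygon in `Λ` with `n` edges. -/
def HasAffinelyRegularIn (Λ : Set ℂ) (n : ℕ) : Prop :=
  ∃ P : Polygon ℂ n, IsAffinelyRegular P ∧ VerticesIn P Λ

end UPoly

end

/-! Write `m = 2n`. The core is that a class `c ≥ 4` forces `2 cos (2π/n)` into the field of `Λ`. If
`u ∈ U` is parallel to an edge, convexity forces the chords of direction `u` to pair the vertices
symmetrically about that edge, and the distance to the edge increases along each half. The vertex
sequence `i ↦ cross u (w i)` is then symmetric, so its first Fourier coefficient is a real multiple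
of a known `2m`-th root of unity, and monotonicity makes the multiple non-zero
(`ConvexCycle.exists_fourierSum_eq`). This coefficient is real-linear in `u`. A single linear map
thus sends the directions of the consecutive edges to multiples of the edge normals of a regular
polygon, with cross ratios unchanged (`ConvexCycle.exists_cross_eq`). For four consecutive edges the
cross ratio is `sin² (2π/n) / sin² (π/n) = 2 + 2 cos (2π/n)`. Computed from vectors of `Λ - Λ`, it
lies in the field (`cycloReal_le_of_class`).

Conversely, if `2 cos (2π/n)` is in the field, a linear map carries all `n`-th roots of unity into
it (`exists_linearEquiv`). A regular `2n`-gon may require a larger field, so a `2n`-gon inscribed in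
the circle at arguments `2πk/n ± α` is used instead. Its edge directions form a set of `n`
directions independent of `α`, for which it is a polygon of class `n` (`semiPolygon_isOfClass`). One
`α` makes the vertices, up to scaling, rational combinations of roots of unity, so (Aff) moves the
polygon into `Λ`; `α = π/(2n)` gives an affinely regular polygon for the same directions.

Affinely regular polygons in `Λ` are tied to the field by the ratio of a diagonal to the edge
parallel to it. Finiteness under (Alg) holds because the degree `φ(n)` of `ζ_n` is at most `2 [K :
ℚ]`, where `K` is the field of `Λ`. -/

noncomputable section

namespace UPoly

/-! ### Determinants of plane vectors -/

/-- The determinant of a pair of plane vectors. -/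
def cross (a b : ℂ) : ℝ := (conj a * b).im

lemma cross_eq (a b : ℂ) : cross a b = a.re * b.im - a.im * b.re := by
  simp [cross, Complex.mul_im]; ring

lemma cross_sub_right (u a b : ℂ) : cross u (a - b) = cross u a - cross u b := by
  simp only [cross_eq, Complex.sub_re, Complex.sub_im]; ring

lemma cross_smul_left (t : ℝ) (a b : ℂ) : cross (t • a) b = t * cross a b := by
  simp [cross_eq]; ring

lemma cross_smul_right (t : ℝ) (a b : ℂ) : cross a (t • b) = t * cross a b := by
  simp [cross_eq]; ring

/-- Vectors of determinant zero with a non-zero vector `u` are multiples of `u`. -/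
lemma exists_smul_of_cross_eq_zero {u z : ℂ} (hu : u ≠ 0) (h : cross u z = 0) :
    ∃ t : ℝ, z = t • u := by
  rw [cross_eq] at h
  by_cases h1 : u.re = 0
  · have h2 : u.im ≠ 0 := fun h2 => hu (Complex.ext h1 h2)
    refine ⟨z.im / u.im, Complex.ext ?_ ?_⟩
    · rw [h1] at h
      have : z.re = 0 := by
        have : u.im * z.re = 0 := by linarith
        exact (mul_eq_zero.mp this).resolve_left h2
      simp [h1, this]
    · simp [h2]
  · refine ⟨z.re / u.re, Complex.ext ?_ ?_⟩
    · simp [h1]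
    · simp only [Complex.smul_im, smul_eq_mul]; field_simp; linarith

lemma Parallel.cross_eq_zero {u z : ℂ} (h : Parallel u z) : cross u z = 0 := by
  obtain ⟨t, -, rfl⟩ := h
  simp [cross_eq]; ring

/-! ### Chords of a convex polygon parallel to an edge -/

/-- `w` runs periodically through the vertices of a convex `m`-gon; the sign of `σ` is its
orientation. -/
structure ConvexCycle (m : ℕ) (σ : ℝ) (w : ℤ → ℂ) : Prop where
  periodic : Function.Periodic w m
  left : ∀ i j : ℤ, i + 1 < j → j < i + m → 0 < σ * cross (w (i + 1) - w i) (w j - w i)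

namespace ConvexCycle

variable {m : ℕ} {σ : ℝ} {w : ℤ → ℂ}

/-- Convexity is given for edges only; it reaches all triples by moving `k` away from `j` one vertex
at a time. The step is the three-term Plücker relation for the vectors from `w i` to the vertices
with indices `i + 1`, `j`, `k`, `k + 1`. -/
lemma triple (h : ConvexCycle m σ w) {i j k : ℤ} (hij : i < j) (hjk : j < k) (hk : k < i + m) :
    0 < σ * cross (w j - w i) (w k - w i) := by
  obtain ⟨d, rfl⟩ : ∃ d : ℕ, k = j + 1 + d := ⟨(k - j - 1).toNat, by omega⟩
  clear hjk
  induction d with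
  | zero =>
    have h1 := h.left j (i + m) (by push_cast at hk; omega) (by omega)
    rw [h.periodic] at h1
    simp only [cross_eq, Complex.sub_re, Complex.sub_im, Nat.cast_zero, add_zero] at h1 ⊢
    linarith
  | succ d ih =>
    have ih := ih (by push_cast at hk ⊢; omega)
    rcases eq_or_lt_of_le (show i + 1 ≤ j by omega) with rfl | hj
    · exact h.left i _ (by push_cast; omega) hk
    have h1 := h.left i j hj (by push_cast at hk; omega)
    have h2 := h.left i (j + 1 + d) (by omega) (by push_cast at hk; omega)
    have h3 := h.left i (j + 1 + (d + 1 : ℕ)) (by push_cast; omega) hk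
    have h4 := h.left (j + 1 + d) (i + m) (by push_cast at hk; omega) (by omega)
    rw [h.periodic] at h4
    rw [show j + 1 + ((d + 1 : ℕ) : ℤ) = j + 1 + d + 1 by push_cast; ring] at h3 ⊢
    generalize w (j + 1 + d + 1) = x at *
    generalize w (j + 1 + d) = y at *
    simp only [cross_eq, Complex.sub_re, Complex.sub_im] at *
    refine pos_of_mul_pos_right (a := σ * ((w (i + 1) - w i).re * (y - w i).im
      - (w (i + 1) - w i).im * (y - w i).re)) ?_ ?_
    · have := add_pos (mul_pos h1 h4) (mul_pos h3 ih)
      simp only [Complex.sub_re, Complex.sub_im]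
      nlinarith
    · simp only [Complex.sub_re, Complex.sub_im]; exact h2.le

/-- The vertices outside an arc cut off by a chord of direction `u` lie on one side of it. -/
lemma same_side (h : ConvexCycle m σ w) {u : ℂ} (hu : u ≠ 0) {a b c d : ℤ} (hab : a < b)
    (hf : cross u (w a) = cross u (w b)) (hbc : b < c) (hc : c < a + m) (hbd : b < d)
    (hd : d < a + m) :
    0 < (cross u (w c) - cross u (w a)) * (cross u (w d) - cross u (w a)) := by
  obtain ⟨t, ht⟩ := exists_smul_of_cross_eq_zero hu (z := w b - w a)
    (by rw [cross_sub_right]; linarith)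
  have h1 := h.triple hab hbc hc
  have h2 := h.triple hab hbd hd
  rw [ht, cross_smul_left, cross_sub_right] at h1 h2
  have h3 := mul_pos h1 h2
  have h4 : 0 ≤ (σ * t) ^ 2 := sq_nonneg _
  refine pos_of_mul_pos_right (a := (σ * t) ^ 2) ?_ h4
  linarith

/-- The same, for vertices indexed by a window of length `m`. -/
lemma same_side_window (h : ConvexCycle m σ w) {u : ℂ} (hu : u ≠ 0) {A a b c d : ℤ} (hA : A ≤ a)
    (hab : a < b) (hb : b < A + m) (hf : cross u (w a) = cross u (w b))
    (hc : A ≤ c ∧ c < a ∨ b < c ∧ c < A + m) (hd : A ≤ d ∧ d < a ∨ b < d ∧ d < A + m) :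
    0 < (cross u (w c) - cross u (w a)) * (cross u (w d) - cross u (w a)) := by
  have key : ∀ c, (A ≤ c ∧ c < a ∨ b < c ∧ c < A + m) → ∃ c', w c' = w c ∧ b < c' ∧ c' < a + m := by
    rintro c (hc | hc)
    · exact ⟨c + m, h.periodic c, by omega, by omega⟩
    · exact ⟨c, rfl, by omega, by omega⟩
  obtain ⟨c', hc', h1, h2⟩ := key c hc
  obtain ⟨d', hd', h3, h4⟩ := key d hd
  rw [← hc', ← hd']
  exact h.same_side hu hab hf h1 h2 h3 h4

lemma ne_window (h : ConvexCycle m σ w) {u : ℂ} (hu : u ≠ 0) {A a b c : ℤ} (hA : A ≤ a)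
    (hab : a < b) (hb : b < A + m) (hf : cross u (w a) = cross u (w b))
    (hc : A ≤ c ∧ c < a ∨ b < c ∧ c < A + m) : cross u (w c) ≠ cross u (w a) := by
  intro he
  have := h.same_side_window hu hA hab hb hf hc hc
  rw [he] at this
  simp at this

/-- The chords of direction `u` join the vertices symmetric with respect to an edge of
direction `u`. -/
lemma pairing_half (h : ConvexCycle m σ w) {u : ℂ} (hu : u ≠ 0) {a : ℤ}
    (hedge : cross u (w a) = cross u (w (a + m - 1)))
    (hpart : ∀ x, ∃ y, a ≤ y ∧ y < a + m ∧ y ≠ x ∧ cross u (w x) = cross u (w y))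
    (k : ℕ) (hk : 2 * k + 1 < m) : cross u (w (a + k)) = cross u (w (a + m - 1 - k)) := by
  induction k using Nat.strong_induction_on with
  | _ k ih =>
  rcases Nat.eq_zero_or_pos k with rfl | hk0
  · simpa using hedge
  -- A line contains at most two vertices, so a vertex already matched at an earlier stage cannot be
  -- the partner of an inner one.
  have outer : ∀ z x : ℤ, a + k ≤ z → z ≤ a + m - 1 - k → cross u (w z) = cross u (w x) →
      a ≤ x → x < a + m → a + k ≤ x ∧ x ≤ a + m - 1 - k := by
    intro z x h1 h2 hf h3 h4
    by_contra hcon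
    have hx : (∃ j : ℕ, j < k ∧ x = a + j) ∨ (∃ j : ℕ, j < k ∧ x = a + m - 1 - j) := by
      by_cases hx : x < a + k
      · exact Or.inl ⟨(x - a).toNat, by omega, by omega⟩
      · exact Or.inr ⟨(a + m - 1 - x).toNat, by omega, by omega⟩
    obtain ⟨j, hj, rfl⟩ | ⟨j, hj, rfl⟩ := hx
    · have e := ih j hj (by omega)
      exact h.ne_window hu (A := a) (a := a + j) (b := z) (c := a + m - 1 - j) (by omega) (by omega)
        (by omega) hf.symm (Or.inr ⟨by omega, by omega⟩) e.symm
    · have e := ih j hj (by omega)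
      exact h.ne_window hu (A := a) (a := z) (b := a + m - 1 - j) (c := a + j) (by omega) (by omega)
        (by omega) hf (Or.inl ⟨by omega, by omega⟩) (e.trans hf.symm)
  by_contra hne
  obtain ⟨q, hq1, hq2, hq3, hq⟩ := hpart (a + k)
  obtain ⟨r, hr1, hr2, hr3, hr⟩ := hpart (a + m - 1 - k)
  have hq' := outer _ _ (by omega) (by omega) hq hq1 hq2
  have hr' := outer _ _ (by omega) (by omega) hr hr1 hr2
  have hql : q ≠ a + m - 1 - k := by rintro rfl; exact hne hq
  have hrl : r ≠ a + k := by rintro rfl; exact hne hr.symm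
  -- Let `p`, `p'`, `p0` be the values of `cross u` at the two inner end vertices and on the edge.
  -- Convexity applied to the chords through the end vertices and to the edge shows that none of the
  -- three values lies between the other two, which is impossible.
  have s1 := h.same_side_window hu (A := a) (a := a + k) (b := q) (c := a) (d := a + m - 1 - k)
    (by omega) (by omega) (by omega) hq (by omega) (by omega)
  have s2 := h.same_side_window hu (A := a) (a := r) (b := a + m - 1 - k) (c := a) (d := a + k)
    (by omega) (by omega) (by omega) hr.symm (by omega) (by omega)
  have hedge' : cross u (w (a - 1)) = cross u (w a) := by
    rw [hedge, ← h.periodic (a - 1)]; congr 2; ring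
  have s3 := h.same_side hu (a := a - 1) (b := a) (c := a + k) (d := a + m - 1 - k)
    (by omega) hedge' (by omega) (by omega) (by omega) (by omega)
  rw [hedge'] at s3
  rw [← hr] at s2
  generalize cross u (w (a + k)) = p at *
  generalize cross u (w (a + m - 1 - k)) = p' at *
  generalize cross u (w a) = p0 at *
  have := mul_pos (mul_pos s1 s2) s3
  nlinarith [mul_nonneg (sq_nonneg ((p - p0) * (p' - p0))) (sq_nonneg (p - p'))]

/-- Along one half of the polygon, the distances to an edge of direction `u` increase. -/
lemma increasing_half (h : ConvexCycle m σ w) {u : ℂ} (hu : u ≠ 0) {a : ℤ}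
    (hedge : cross u (w a) = cross u (w (a + m - 1)))
    (hpair : ∀ k : ℕ, 2 * k + 1 < m → cross u (w (a + k)) = cross u (w (a + m - 1 - k)))
    {i j k : ℕ} (hk : 0 < k) (hkm : 2 * k + 1 < m) (hij : i < j) (hj : 2 * j + 1 < m) :
    0 < (cross u (w (a + k)) - cross u (w a)) * (cross u (w (a + j)) - cross u (w (a + i))) := by
  have hedge' : cross u (w (a - 1)) = cross u (w a) := by
    rw [hedge, ← h.periodic (a - 1)]; congr 2; ring
  have s1 := h.same_side hu (a := a - 1) (b := a) (c := a + k) (d := a + j)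
    (by omega) hedge' (by omega) (by omega) (by omega) (by omega)
  have s2 := h.same_side_window hu (A := a) (a := a + j) (b := a + m - 1 - j) (c := a) (d := a + i)
    (by omega) (by omega) (by omega) (hpair j hj) (by omega) (by omega)
  rw [hedge'] at s1
  generalize cross u (w (a + k)) = p at *
  generalize cross u (w (a + j)) = p' at *
  generalize cross u (w (a + i)) = p'' at *
  generalize cross u (w a) = p0 at *
  have s3 := mul_pos s1 s2
  refine pos_of_mul_pos_right (a := (p' - p0) ^ 2) ?_ (sq_nonneg _)
  linarith

end ConvexCycle

/-! ### The first Fourier coefficient and directions of edges -/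

/-- The first Fourier coefficient of an `m`-periodic real sequence. -/
def fourierSum (m : ℕ) (g : ℤ → ℝ) : ℂ :=
  ∑ i ∈ Finset.range m, (g i : ℂ) * Complex.exp (((2 * i * Real.pi / m : ℝ) : ℂ) * Complex.I)

lemma sum_range_shift {M : Type*} [AddCommGroup M] {m : ℕ} {F : ℕ → M}
    (hF : ∀ k, F (k + m) = F k) (a : ℕ) :
    ∑ i ∈ Finset.range m, F (a + i) = ∑ i ∈ Finset.range m, F i := by
  induction a with
  | zero => simp
  | succ a ih =>
    have h1 := Finset.sum_range_succ (fun i => F (a + i)) m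
    have h2 := Finset.sum_range_succ' (fun i => F (a + i)) m
    rw [h1, hF, add_zero] at h2
    have h3 := add_right_cancel h2
    rw [← ih, h3]
    exact Finset.sum_congr rfl fun i _ => by congr 1; omega

/-- The phase factored out is the midpoint of the arguments at indices `a - 1` and `a`, that is, the
axis of symmetry. The reflection `k ↦ m - 1 - k` negates the remaining sines, so only a real cosine
sum survives. -/
lemma fourierSum_eq_of_symmetric {m : ℕ} (hm : 0 < m) {g : ℤ → ℝ} (hg : Function.Periodic g m)
    (a : ℕ) (hsymm : ∀ k : ℕ, k < m → g (a + k) = g (a + m - 1 - k)) :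
    fourierSum m g =
      ((∑ k ∈ Finset.range m, g (a + k) * Real.cos ((2 * k + 1) * Real.pi / m) : ℝ) : ℂ) *
        Complex.exp ((((2 * a - 1) * Real.pi / m : ℝ) : ℂ) * Complex.I) := by
  have hm' : (m : ℝ) ≠ 0 := by positivity
  have hmC : (m : ℂ) ≠ 0 := by exact_mod_cast hm.ne'
  set F : ℕ → ℂ := fun i =>
    (g i : ℂ) * Complex.exp (((2 * i * Real.pi / m : ℝ) : ℂ) * Complex.I) with hFdef
  have hF : ∀ k, F (k + m) = F k := by
    intro k
    simp only [hFdef]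
    have h1 : g ((k + m : ℕ) : ℤ) = g k := by push_cast; exact hg k
    rw [h1]
    congr 1
    rw [show (((2 * ((k + m : ℕ) : ℝ) * Real.pi / m : ℝ) : ℂ) * Complex.I) =
      ((2 * k * Real.pi / m : ℝ) : ℂ) * Complex.I + 2 * Real.pi * Complex.I by
        push_cast; field_simp]
    rw [Complex.exp_add, Complex.exp_two_pi_mul_I, mul_one]
  have h1 : fourierSum m g = ∑ i ∈ Finset.range m, F (a + i) := by
    rw [sum_range_shift hF]; rfl
  have h2 : ∀ k : ℕ, F (a + k) =
      Complex.exp ((((2 * a - 1) * Real.pi / m : ℝ) : ℂ) * Complex.I) *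
      (((g (a + k) * Real.cos ((2 * k + 1) * Real.pi / m) : ℝ) : ℂ) +
        ((g (a + k) * Real.sin ((2 * k + 1) * Real.pi / m) : ℝ) : ℂ) * Complex.I) := by
    intro k
    have : ((((2 * ((a + k : ℕ) : ℝ) * Real.pi / m : ℝ) : ℂ)) * Complex.I) =
      ((((2 * a - 1) * Real.pi / m : ℝ) : ℂ) * Complex.I) +
        ((((2 * k + 1) * Real.pi / m : ℝ) : ℂ) * Complex.I) := by
      push_cast; field_simp; ring
    simp only [hFdef]
    rw [this, Complex.exp_add, Complex.exp_mul_I (((2 * k + 1) * Real.pi / m : ℝ) : ℂ),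
      ← Complex.ofReal_cos, ← Complex.ofReal_sin]
    push_cast
    ring
  have h3 : ∑ k ∈ Finset.range m, g (a + k) * Real.sin ((2 * k + 1) * Real.pi / m) = 0 := by
    have h4 := Finset.sum_range_reflect
      (fun k : ℕ => g (a + k) * Real.sin ((2 * k + 1) * Real.pi / m)) m
    have h5 : ∑ j ∈ Finset.range m, (fun k : ℕ => g (a + k) * Real.sin ((2 * k + 1) * Real.pi / m))
        (m - 1 - j) = - ∑ k ∈ Finset.range m, g (a + k) * Real.sin ((2 * k + 1) * Real.pi / m) := by
      rw [← Finset.sum_neg_distrib]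
      refine Finset.sum_congr rfl fun j hj => ?_
      have hj := Finset.mem_range.mp hj
      have e1 : ((m - 1 - j : ℕ) : ℝ) = m - 1 - j := by
        rw [Nat.sub_sub, Nat.cast_sub (by omega)]; push_cast; ring
      have e2 : ((m - 1 - j : ℕ) : ℤ) = m - 1 - j := by omega
      simp only []
      rw [hsymm j hj, e1, e2,
        show (a : ℤ) + (m - 1 - j) = a + m - 1 - j by ring,
        show (2 * ((m : ℝ) - 1 - j) + 1) * Real.pi / m =
          2 * Real.pi - (2 * j + 1) * Real.pi / m by field_simp; ring, Real.sin_two_pi_sub]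
      ring
    linarith
  rw [h1, Finset.sum_congr rfl fun k _ => h2 k, ← Finset.mul_sum, Finset.sum_add_distrib,
    ← Finset.sum_mul, ← Complex.ofReal_sum, ← Complex.ofReal_sum, h3]
  simp [mul_comm]

/-- A sequence which is symmetric and monotone along a half-period has non-zero cosine sum. -/
lemma cosSum_ne_zero {n : ℕ} (hn : 2 ≤ n) (G : ℕ → ℝ)
    (hsymm : ∀ k < n, G (n + n - 1 - k) = G k)
    (hmono : ∀ i j k : ℕ, 0 < k → k < n → i < j → j < n → 0 < (G k - G 0) * (G j - G i)) :
    ∑ k ∈ Finset.range (n + n), G k * Real.cos ((2 * k + 1) * Real.pi / (n + n : ℕ)) ≠ 0 := by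
  have hn0 : (n : ℝ) ≠ 0 := by positivity
  set c : ℕ → ℝ := fun k => Real.cos ((2 * k + 1) * Real.pi / (n + n : ℕ)) with hc
  have hc1 : ∀ k < n, c (n + n - 1 - k) = c k := by
    intro k hk
    simp only [hc]
    rw [show ((n + n - 1 - k : ℕ) : ℝ) = n + n - 1 - k by
      rw [Nat.sub_sub, Nat.cast_sub (by omega)]; push_cast; ring,
      show (2 * ((n : ℝ) + n - 1 - k) + 1) * Real.pi / (n + n : ℕ) =
        2 * Real.pi - (2 * k + 1) * Real.pi / (n + n : ℕ) by push_cast; field_simp; ring,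
      Real.cos_two_pi_sub]
  have hc2 : ∀ k < n, c (n - 1 - k) = - c k := by
    intro k hk
    simp only [hc]
    rw [show ((n - 1 - k : ℕ) : ℝ) = n - 1 - k by
      rw [Nat.sub_sub, Nat.cast_sub (by omega)]; push_cast; ring,
      show (2 * ((n : ℝ) - 1 - k) + 1) * Real.pi / (n + n : ℕ) =
        Real.pi - (2 * k + 1) * Real.pi / (n + n : ℕ) by push_cast; field_simp; ring,
      Real.cos_pi_sub]
  have hpos : ∀ k : ℕ, 2 * k + 1 < n → 0 < c k := by
    intro k hk
    refine Real.cos_pos_of_mem_Ioo ⟨?_, ?_⟩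
    · have : 0 < (2 * (k : ℝ) + 1) * Real.pi / (n + n : ℕ) := by positivity
      linarith [Real.pi_pos]
    · push_cast
      rw [div_lt_div_iff₀ (by positivity) two_pos]
      have : (2 * (k : ℝ) + 1) < n := by exact_mod_cast hk
      nlinarith [Real.pi_pos]
  have e1 : ∑ k ∈ Finset.range (n + n), G k * c k = 2 * ∑ k ∈ Finset.range n, G k * c k := by
    rw [Finset.sum_range_add, ← Finset.sum_range_reflect (fun x => G (n + x) * c (n + x)), two_mul]
    congr 1
    refine Finset.sum_congr rfl fun k hk => ?_
    have hk := Finset.mem_range.mp hk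
    rw [← hsymm k hk, ← hc1 k hk, show n + (n - 1 - k) = n + n - 1 - k by omega]
  have e2 : ∑ k ∈ Finset.range n, G k * c k = - ∑ k ∈ Finset.range n, G (n - 1 - k) * c k := by
    rw [← Finset.sum_range_reflect, ← Finset.sum_neg_distrib]
    refine Finset.sum_congr rfl fun k hk => ?_
    rw [hc2 k (Finset.mem_range.mp hk)]; ring
  -- Folding at the half-period and again at the quarter-period pairs differences of `G` with
  -- cosines. Both factors change sign at the quarter-period, so all terms have the same sign, and
  -- the term `k = 0` is not zero.
  have e3 : ∑ k ∈ Finset.range (n + n), G k * c k =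
      ∑ k ∈ Finset.range n, (G k - G (n - 1 - k)) * c k := by
    rw [e1, two_mul]; nth_rewrite 2 [e2]
    rw [← sub_eq_add_neg, ← Finset.sum_sub_distrib]
    exact Finset.sum_congr rfl fun k _ => by ring
  have e4 : 0 < ∑ k ∈ Finset.range n, (G 1 - G 0) * ((G (n - 1 - k) - G k) * c k) := by
    refine Finset.sum_pos' ?_ ⟨0, by simp; omega, ?_⟩
    · intro k hk
      have hk := Finset.mem_range.mp hk
      rcases lt_trichotomy (2 * k + 1) n with h | h | h
      · have := mul_pos (hmono k (n - 1 - k) 1 (by omega) (by omega) (by omega) (by omega))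
          (hpos k h)
        linarith
      · rw [show n - 1 - k = k by omega]; simp
      · have h1 := hpos (n - 1 - k) (by omega)
        rw [hc2 k hk] at h1
        have := mul_pos (hmono (n - 1 - k) k 1 (by omega) (by omega) (by omega) (by omega)) h1
        linarith
    · have := mul_pos (hmono 0 (n - 1 - 0) 1 (by omega) (by omega) (by omega) (by omega))
        (hpos 0 (by omega))
      linarith
  intro h0
  rw [← Finset.mul_sum] at e4
  have : ∑ k ∈ Finset.range n, (G (n - 1 - k) - G k) * c k = 0 := by
    rw [← neg_eq_zero, ← Finset.sum_neg_distrib, ← h0, e3]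
    exact Finset.sum_congr rfl fun k _ => by ring
  rw [this] at e4
  simp at e4

/-- Real-linearity in `u`: the two coordinate sequences determine the coefficients for all
directions. -/
lemma fourierSum_cross (m : ℕ) (u : ℂ) (w : ℤ → ℂ) :
    fourierSum m (fun i => cross u (w i)) =
      u.re * fourierSum m (fun i => (w i).im) - u.im * fourierSum m (fun i => (w i).re) := by
  simp only [fourierSum, Finset.mul_sum, ← Finset.sum_sub_distrib, cross_eq]
  refine Finset.sum_congr rfl fun i _ => ?_
  push_cast; ring

/-- The vertices of the polygon lie in pairs on the lines of direction `u`. -/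
def Paired (u : ℂ) (w : ℤ → ℂ) : Prop := ∀ x, ∃ y, w y ≠ w x ∧ cross u (w x) = cross u (w y)

/-- The Fourier coefficient of a paired polygon in a direction parallel to an edge. -/
lemma ConvexCycle.exists_fourierSum_eq {n : ℕ} {σ : ℝ} {w : ℤ → ℂ} (hn : 2 ≤ n)
    (h : ConvexCycle (n + n) σ w) {u : ℂ} (hu : u ≠ 0) (hp : Paired u w) (a : ℕ)
    (hedge : cross u (w (a + 1) - w a) = 0) :
    ∃ R : ℝ, R ≠ 0 ∧ fourierSum (n + n) (fun i => cross u (w i)) =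
      R * Complex.exp ((((2 * a + 1) * Real.pi / (n + n : ℕ) : ℝ) : ℂ) * Complex.I) := by
  -- The window starts just after the edge, whose endpoints thus become the last and first vertices
  -- of the window.
  set b : ℤ := a + 1 with hb
  have hedge' : cross u (w b) = cross u (w (b + (n + n : ℕ) - 1)) := by
    rw [show b + (n + n : ℕ) - 1 = a + (n + n : ℕ) by omega, h.periodic]
    rw [cross_sub_right] at hedge; linarith
  have hpart : ∀ x, ∃ y, b ≤ y ∧ y < b + (n + n : ℕ) ∧ y ≠ x ∧ cross u (w x) = cross u (w y) := by
    intro x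
    obtain ⟨y, hy1, hy2⟩ := hp x
    have hw : w (b + (y - b) % (n + n : ℕ)) = w y := by
      rw [show b + (y - b) % (n + n : ℕ) = y - ((y - b) / (n + n : ℕ) : ℤ) * (n + n : ℕ) by
        have := Int.emod_add_mul_ediv (y - b) (n + n : ℕ); linarith]
      exact h.periodic.sub_int_mul_eq _
    refine ⟨b + (y - b) % (n + n : ℕ), ?_, ?_, ?_, by rw [hw, hy2]⟩
    · have := Int.emod_nonneg (y - b) (b := (n + n : ℕ)) (by omega); omega
    · have := Int.emod_lt_of_pos (y - b) (b := (n + n : ℕ)) (by omega); omega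
    · rintro he
      rw [he] at hw
      exact hy1 hw.symm
  have hpair := fun k hk => h.pairing_half hu hedge' hpart k hk
  set g : ℤ → ℝ := fun i => cross u (w i) with hg
  have hsymm : ∀ k : ℕ, k < n + n → g ((a + 1 : ℕ) + k) = g ((a + 1 : ℕ) + (n + n : ℕ) - 1 - k) := by
    intro k hk
    by_cases hk2 : 2 * k + 1 < n + n
    · have := hpair k hk2
      simpa [hg, hb] using this
    · have := hpair (n + n - 1 - k) (by omega)
      have e : ((n + n - 1 - k : ℕ) : ℤ) = (n + n : ℕ) - 1 - k := by omega
      rw [e] at this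
      simp only [hg]
      convert this.symm using 3 <;> push_cast [hb] <;> ring
  have hF := fourierSum_eq_of_symmetric (m := n + n) (by omega) (g := g)
    (fun x => by simp only [hg]; rw [h.periodic]) (a + 1) hsymm
  rw [show 2 * ((a + 1 : ℕ) : ℝ) - 1 = 2 * a + 1 by push_cast; ring] at hF
  refine ⟨_, ?_, hF⟩
  refine cosSum_ne_zero hn (fun k => g ((a + 1 : ℕ) + k)) ?_ ?_
  · intro k hk
    rw [hsymm k (by omega)]
    congr 1
    omega
  · intro i j k hk hkn hij hj
    have := h.increasing_half hu hedge' hpair (i := i) (j := j) (k := k) hk (by omega) hij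
      (by omega)
    simpa [hg, hb] using this

/-- The determinants of directions of edges are proportional to those in a regular polygon. -/
lemma ConvexCycle.exists_cross_eq {n : ℕ} {σ : ℝ} {w : ℤ → ℂ} (hn : 2 ≤ n)
    (h : ConvexCycle (n + n) σ w) (l : ℕ) (u : ℕ → ℂ) (hu : ∀ a < l, u a ≠ 0)
    (hp : ∀ a < l, Paired (u a) w)
    (hedge : ∀ a < l, cross (u a) (w ((a : ℤ) + 1) - w a) = 0) :
    ∃ (D : ℝ) (R : ℕ → ℝ), (∀ a < l, R a ≠ 0) ∧ ∀ a < l, ∀ b < l,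
      cross (u a) (u b) * D = R a * R b * Real.sin ((b - a) * (Real.pi / n)) := by
  choose! R hR0 hR using fun a (ha : a < l) =>
    h.exists_fourierSum_eq hn (hu a ha) (hp a ha) a (hedge a ha)
  refine ⟨cross (fourierSum (n + n) fun i => (w i).re) (fourierSum (n + n) fun i => (w i).im), R,
    hR0, ?_⟩
  intro a ha b hb
  have h1 := (fourierSum_cross (n + n) (u a) w).symm.trans (hR a ha)
  have h2 := (fourierSum_cross (n + n) (u b) w).symm.trans (hR b hb)
  generalize (fourierSum (n + n) fun i => (w i).re) = A at *
  generalize (fourierSum (n + n) fun i => (w i).im) = B at *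
  -- The linear map `u ↦ u.re * B - u.im * A` multiplies determinants by `cross A B`, while on the
  -- right the determinant of two points on the unit circle is the sine of the difference of
  -- arguments.
  have h3 := congrArg₂ cross h1 h2
  rw [show (b - a : ℝ) * (Real.pi / n) = (2 * b + 1) * Real.pi / (n + n : ℕ) -
    (2 * a + 1) * Real.pi / (n + n : ℕ) by push_cast; field_simp; ring, Real.sin_sub]
  simp only [cross_eq, Complex.sub_re, Complex.sub_im, Complex.re_ofReal_mul,
    Complex.im_ofReal_mul, Complex.exp_ofReal_mul_I_re, Complex.exp_ofReal_mul_I_im] at h3 ⊢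
  linear_combination h3

/-! ### From cyclic indices to periodic sequences -/

lemma val_finRotate {m : ℕ} (i : Fin m) : (finRotate m i : ℕ) = (i + 1) % m := by
  have := i.neZero
  rw [finRotate_apply, Fin.val_add, Fin.val_one', Nat.add_mod_mod]

lemma val_iterate_finRotate {m : ℕ} (i : Fin m) (k : ℕ) :
    (((finRotate m)^[k] i : Fin m) : ℕ) = (i + k) % m := by
  induction k with
  | zero => simp [Nat.mod_eq_of_lt i.2]
  | succ k ih => rw [Function.iterate_succ_apply', val_finRotate, ih, Nat.mod_add_mod, add_assoc]

/-- The residue of an integer as an index. -/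
def residue (m : ℕ) (hm : 0 < m) (k : ℤ) : Fin m :=
  ⟨(k % m).toNat, by
    have := Int.emod_lt_of_pos k (b := m) (by omega)
    omega⟩

lemma coe_residue {m : ℕ} (hm : 0 < m) (k : ℤ) : ((residue m hm k : ℕ) : ℤ) = k % m := by
  have := Int.emod_nonneg k (b := m) (by omega)
  simp [residue]; omega

lemma residue_eq_iff {m : ℕ} (hm : 0 < m) (k : ℤ) (i : Fin m) :
    residue m hm k = i ↔ k % m = (i : ℕ) := by
  rw [← coe_residue hm, Fin.ext_iff]; norm_cast

lemma residue_val {m : ℕ} (hm : 0 < m) (i : Fin m) : residue m hm (i : ℕ) = i := by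
  rw [residue_eq_iff]; exact_mod_cast Nat.mod_eq_of_lt i.2

lemma finRotate_residue {m : ℕ} (hm : 0 < m) (k : ℤ) :
    finRotate m (residue m hm k) = residue m hm (k + 1) := by
  symm
  rw [residue_eq_iff, val_finRotate]
  push_cast
  rw [coe_residue, Int.emod_add_emod]

lemma residue_ne {m : ℕ} (hm : 0 < m) {i j : ℤ} (hij : i < j) (hj : j < i + m) :
    residue m hm j ≠ residue m hm i := by
  intro h
  rw [residue_eq_iff, coe_residue] at h
  have h2 : (m : ℤ) ∣ j - i := Int.dvd_of_emod_eq_zero (Int.emod_eq_emod_iff_emod_sub_eq_zero.mp h)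
  have := Int.le_of_dvd (by omega) h2
  omega

/-- The offset `i₀` lets a given run of edges start at index `0`; the orientation is absorbed in `σ
= ±1`. -/
lemma IsConvexPolygon.exists_convexCycle {m : ℕ} (hm : 0 < m) {P : Polygon ℂ m}
    (hP : IsConvexPolygon P) (i₀ : ℤ) :
    ∃ σ : ℝ, ConvexCycle m σ fun k => P (residue m hm (i₀ + k)) := by
  have hper : Function.Periodic (fun k => P (residue m hm (i₀ + k))) m := by
    intro k
    simp only []
    congr 1
    rw [residue_eq_iff, coe_residue, ← add_assoc]; simp
  have key : ∀ i j : ℤ, i + 1 < j → j < i + m →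
      residue m hm (i₀ + j) ≠ residue m hm (i₀ + i) ∧
      residue m hm (i₀ + j) ≠ finRotate m (residue m hm (i₀ + i)) := fun i j h1 h2 =>
    ⟨residue_ne hm (by omega) (by omega), by
      rw [finRotate_residue]; exact residue_ne hm (by omega) (by omega)⟩
  rcases hP.2 with h | h
  · refine ⟨1, hper, fun i j h1 h2 => ?_⟩
    have := h _ _ (key i j h1 h2).1 (key i j h1 h2).2
    rw [edgeVec, finRotate_residue] at this
    rw [one_mul, ← add_assoc]; exact this
  · refine ⟨-1, hper, fun i j h1 h2 => ?_⟩
    have := h _ _ (key i j h1 h2).1 (key i j h1 h2).2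
    rw [edgeVec, finRotate_residue] at this
    rw [neg_one_mul, neg_pos, ← add_assoc]; exact this

/-! ### The cross ratio of four consecutive edges lies in the field -/

lemma subset_fieldK (Λ : Set ℂ) : Λ - Λ ⊆ (fieldK Λ : Set ℂ) := fun _ hz =>
  IntermediateField.subset_adjoin _ _ (Or.inl hz)

lemma conj_mem_fieldK {Λ : Set ℂ} {z : ℂ} (hz : z ∈ Λ - Λ) : conj z ∈ fieldK Λ :=
  IntermediateField.subset_adjoin _ _ (Or.inr ⟨z, hz, rfl⟩)

lemma ofReal_mem_realField (r : ℝ) : (r : ℂ) ∈ realField := ⟨r, rfl⟩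

lemma mem_realField_iff {z : ℂ} : z ∈ realField ↔ z.im = 0 := by
  constructor
  · rintro ⟨r, rfl⟩; exact Complex.ofReal_im r
  · intro h
    rw [show z = (z.re : ℂ) from Complex.ext rfl (by simp [h])]
    exact ofReal_mem_realField _

lemma zeta_eq (n : ℕ) : zeta n = Complex.exp (((2 * Real.pi / n : ℝ) : ℂ) * Complex.I) := by
  rw [zeta]; congr 1; push_cast; ring

lemma zeta_add_conj (n : ℕ) :
    zeta n + conj (zeta n) = ((2 * Real.cos (2 * Real.pi / n) : ℝ) : ℂ) := by
  rw [Complex.add_conj, zeta_eq, Complex.exp_ofReal_mul_I_re]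

lemma cycloReal_le_fieldk_iff {Λ : Set ℂ} {n : ℕ} :
    cycloReal n ≤ fieldk Λ ↔ ((2 * Real.cos (2 * Real.pi / n) : ℝ) : ℂ) ∈ fieldK Λ := by
  rw [cycloReal, IntermediateField.adjoin_le_iff, Set.singleton_subset_iff, zeta_add_conj]
  exact ⟨fun h => h.1, fun h => ⟨h, ofReal_mem_realField _⟩⟩

/-- The factor `2i` turns the determinant into `conj a * b - a * conj b`; it cancels in every cross
ratio. -/
lemma cross_mul_I_mem {Λ : Set ℂ} {a b : ℂ} (ha : a ∈ Λ - Λ) (hb : b ∈ Λ - Λ) :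
    (cross a b : ℂ) * (2 * Complex.I) ∈ fieldK Λ := by
  have : (cross a b : ℂ) * (2 * Complex.I) = conj a * b - a * conj b := by
    apply Complex.ext <;> (simp [cross_eq]; try ring)
  rw [this]
  exact sub_mem (mul_mem (conj_mem_fieldK ha) (subset_fieldK Λ hb))
    (mul_mem (subset_fieldK Λ ha) (conj_mem_fieldK hb))

lemma Parallel.cross_eq_zero_iff {u z : ℂ} (h : Parallel u z) (x : ℂ) :
    cross z x = 0 ↔ cross u x = 0 := by
  obtain ⟨t, ht, rfl⟩ := h
  rw [cross_smul_left]; simp [ht]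

/-- A `U`-polygon of class at least four with `2n` edges, for a set `U` of `Λ`-directions, forces
`2 cos (2π/n)` into the field of `Λ`. -/
lemma cycloReal_le_of_class {Λ : Set ℂ} {n : ℕ} (hn : 2 ≤ n) {U : Finset ℂ}
    {P : Polygon ℂ (n + n)} {c : ℕ} (hc : 4 ≤ c) (hP : IsOfClass U P c)
    (hU : ∀ u ∈ U, IsLambdaDirection Λ u) : cycloReal n ≤ fieldk Λ := by
  obtain ⟨⟨-, hconv, hpair⟩, ⟨-, hcU, i, hrun⟩, -⟩ := hP
  have hm : 0 < n + n := by omega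
  -- The unit vectors need not have coordinates in the field, so each is replaced by a parallel
  -- vector of `Λ - Λ`.
  have hz : ∀ j < 4, ∃ z ∈ Λ - Λ, z ≠ 0 ∧ ∃ u ∈ U, Parallel u z ∧
      cross u (edgeVec P ((finRotate (n + n))^[j] i)) = 0 := by
    intro j hj
    obtain ⟨u, hu, hpar⟩ := hrun j (by omega)
    obtain ⟨-, z, hz, hz0, huz⟩ := hU u hu
    exact ⟨z, hz, hz0, u, hu, huz, hpar.cross_eq_zero⟩
  choose! z hzΛ hz0 hze using hz
  obtain ⟨σ, hcyc⟩ := hconv.exists_convexCycle hm (i : ℕ)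
  set w : ℤ → ℂ := fun k => P (residue (n + n) hm ((i : ℕ) + k)) with hw
  have hpaired : ∀ a < 4, Paired (z a) w := by
    intro a ha x
    obtain ⟨u, hu, huz, -⟩ := hze a ha
    obtain ⟨j, hj, t, ht⟩ := hpair u hu (residue (n + n) hm ((i : ℕ) + x))
    have hj' : w ((j : ℕ) - (i : ℕ)) = P j := by
      simp only [hw]; congr 1
      rw [add_sub_cancel, residue_val]
    refine ⟨(j : ℕ) - (i : ℕ), by rw [hj']; exact hj, ?_⟩
    rw [eq_comm, ← sub_eq_zero, ← cross_sub_right, huz.cross_eq_zero_iff, hj']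
    simp only [hw]
    rw [ht, add_sub_cancel_left, cross_smul_right]
    simp [cross_eq, mul_comm]
  have hedge : ∀ a < 4, cross (z a) (w ((a : ℤ) + 1) - w a) = 0 := by
    intro a ha
    obtain ⟨u, hu, huz, he⟩ := hze a ha
    rw [huz.cross_eq_zero_iff]
    rw [edgeVec, show (finRotate (n + n))^[a] i = residue (n + n) hm ((i : ℕ) + a) by
      symm; rw [residue_eq_iff, val_iterate_finRotate]; push_cast; rfl, finRotate_residue] at he
    simp only [hw]
    rw [← add_assoc]; exact he
  obtain ⟨D, R, hR, hDR⟩ := hcyc.exists_cross_eq hn 4 z hz0 hpaired hedge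
  have hsin : Real.sin (Real.pi / n) ≠ 0 := by
    refine (Real.sin_pos_of_pos_of_lt_pi (by positivity) ?_).ne'
    rw [div_lt_iff₀ (by positivity)]
    have : (2 : ℝ) ≤ n := by exact_mod_cast hn
    nlinarith [Real.pi_pos]
  have h01 := hDR 0 (by omega) 1 (by omega)
  have h23 := hDR 2 (by omega) 3 (by omega)
  have h02 := hDR 0 (by omega) 2 (by omega)
  have h13 := hDR 1 (by omega) 3 (by omega)
  push_cast at h01 h23 h02 h13
  norm_num at h01 h23 h02 h13
  rw [Real.sin_two_mul] at h02 h13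
  have r0 := hR 0 (by omega)
  have r1 := hR 1 (by omega)
  have r2 := hR 2 (by omega)
  have r3 := hR 3 (by omega)
  have n01 : cross (z 0) (z 1) * D ≠ 0 := by rw [h01]; positivity
  have n23 : cross (z 2) (z 3) * D ≠ 0 := by rw [h23]; positivity
  have hD := right_ne_zero_of_mul n01
  have c01 := left_ne_zero_of_mul n01
  have c23 := left_ne_zero_of_mul n23
  -- In the cross ratio `D` and all `R a` cancel, leaving `sin² (2π/n) / sin² (π/n) = 4 cos² (π/n)`.
  have hmain : cross (z 0) (z 2) * cross (z 1) (z 3) =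
      (2 + 2 * Real.cos (2 * Real.pi / n)) * (cross (z 0) (z 1) * cross (z 2) (z 3)) := by
    rw [mul_div_assoc, Real.cos_two_mul]
    refine mul_right_cancel₀ (mul_ne_zero hD hD) ?_
    calc _ = (cross (z 0) (z 2) * D) * (cross (z 1) (z 3) * D) := by ring
      _ = (4 * Real.cos (Real.pi / n) ^ 2) * ((cross (z 0) (z 1) * D) * (cross (z 2) (z 3) * D)) := by
        rw [h02, h13, h01, h23]; ring
      _ = _ := by ring
  rw [cycloReal_le_fieldk_iff]
  have hmem := sub_mem (div_mem
    (mul_mem (cross_mul_I_mem (hzΛ 0 (by omega)) (hzΛ 2 (by omega)))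
      (cross_mul_I_mem (hzΛ 1 (by omega)) (hzΛ 3 (by omega))))
    (mul_mem (cross_mul_I_mem (hzΛ 0 (by omega)) (hzΛ 1 (by omega)))
      (cross_mul_I_mem (hzΛ 2 (by omega)) (hzΛ 3 (by omega))))) (natCast_mem (fieldK Λ) 2)
  convert hmem using 1
  have hmain' := congrArg (fun x : ℝ => (x : ℂ)) hmain
  have d01 : (cross (z 0) (z 1) : ℂ) ≠ 0 := by exact_mod_cast c01
  have d23 : (cross (z 2) (z 3) : ℂ) ≠ 0 := by exact_mod_cast c23
  push_cast at hmain' ⊢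
  rw [eq_sub_iff_add_eq, eq_div_iff (by simp [d01, d23])]
  linear_combination (-4 * Complex.I ^ 2) * hmain'

/-! ### Affine images of polygons inscribed in the unit circle -/

lemma linearEquiv_apply_eq (L : ℂ ≃ₗ[ℝ] ℂ) (z : ℂ) : L z = z.re • L 1 + z.im • L Complex.I := by
  rw [← map_smul, ← map_smul, ← map_add]
  congr 1
  apply Complex.ext <;> simp

lemma exists_cross_map (L : ℂ ≃ₗ[ℝ] ℂ) : ∃ d : ℝ, d ≠ 0 ∧ ∀ a b, cross (L a) (L b) = d * cross a b := by
  refine ⟨cross (L 1) (L Complex.I), fun h => ?_, fun a b => ?_⟩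
  · obtain ⟨t, ht⟩ := exists_smul_of_cross_eq_zero (by simp) h
    rw [← map_smul] at ht
    simpa using congrArg Complex.im (L.injective ht)
  · rw [linearEquiv_apply_eq L a, linearEquiv_apply_eq L b]
    simp [cross_eq]; ring

/-- The point of argument `x` on the unit circle. -/
def circlePt (x : ℝ) : ℂ := Complex.exp (x * Complex.I)

lemma circlePt_re (x : ℝ) : (circlePt x).re = Real.cos x := Complex.exp_ofReal_mul_I_re x

lemma circlePt_im (x : ℝ) : (circlePt x).im = Real.sin x := Complex.exp_ofReal_mul_I_im x

lemma circlePt_add (x y : ℝ) : circlePt (x + y) = circlePt x * circlePt y := by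
  simp [circlePt, add_mul, Complex.exp_add]

lemma circlePt_add_two_pi (x : ℝ) : circlePt (x + 2 * Real.pi) = circlePt x := by
  apply Complex.ext <;> simp [circlePt_re, circlePt_im]

lemma circlePt_add_pi (x : ℝ) : circlePt (x + Real.pi) = - circlePt x := by
  apply Complex.ext <;> simp [circlePt_re, circlePt_im]

lemma circlePt_ne_zero (x : ℝ) : circlePt x ≠ 0 := Complex.exp_ne_zero _

lemma circlePt_nat_mul (k : ℕ) (x : ℝ) : circlePt (k * x) = circlePt x ^ k := by
  rw [circlePt, circlePt, ← Complex.exp_nat_mul]; congr 1; push_cast; ring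

lemma zeta_eq_circlePt (n : ℕ) : zeta n = circlePt (2 * Real.pi / n) := zeta_eq n

lemma cross_circlePt (x y : ℝ) : cross (circlePt x) (circlePt y) = Real.sin (y - x) := by
  rw [cross_eq, circlePt_re, circlePt_im, circlePt_re, circlePt_im, Real.sin_sub]; ring

/-- As a product, the determinant is visibly positive when `x < y < z < x + 2π`; convexity of
inscribed polygons rests on this. -/
lemma cross_circlePt_sub (x y z : ℝ) :
    cross (circlePt y - circlePt x) (circlePt z - circlePt x) =
      4 * Real.sin ((y - x) / 2) * Real.sin ((z - y) / 2) * Real.sin ((z - x) / 2) := by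
  have h1 : cross (circlePt y - circlePt x) (circlePt z - circlePt x) =
      Real.sin (z - y) + Real.sin (y - x) - Real.sin (z - x) := by
    rw [Real.sin_sub, Real.sin_sub, Real.sin_sub]
    simp only [cross_eq, Complex.sub_re, Complex.sub_im, circlePt_re, circlePt_im]; ring
  rw [h1]
  obtain ⟨p, hp⟩ : ∃ p, p = (y - x) / 2 := ⟨_, rfl⟩
  obtain ⟨q, hq⟩ : ∃ q, q = (z - y) / 2 := ⟨_, rfl⟩
  rw [← hp, ← hq, show z - y = 2 * q by linarith, show y - x = 2 * p by linarith,
    show z - x = 2 * (p + q) by linarith, show 2 * (p + q) / 2 = p + q by ring,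
    Real.sin_two_mul, Real.sin_two_mul, Real.sin_two_mul, Real.sin_add, Real.cos_add]
  linear_combination -2 * Real.sin q * Real.cos q * (Real.sin_sq_add_cos_sq p)
    - 2 * Real.sin p * Real.cos p * (Real.sin_sq_add_cos_sq q)

/-- Up to a real factor, a chord depends only on the sum of the arguments of its endpoints. -/
lemma circlePt_sub (x y : ℝ) : circlePt x - circlePt y =
    (2 * Real.sin ((x - y) / 2)) • (Complex.I * circlePt ((x + y) / 2)) := by
  obtain ⟨p, hp⟩ : ∃ p, p = (x - y) / 2 := ⟨_, rfl⟩
  obtain ⟨q, hq⟩ : ∃ q, q = (x + y) / 2 := ⟨_, rfl⟩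
  rw [← hp, ← hq, show x = q + p by linarith, show y = q - p by linarith]
  apply Complex.ext
  · simp only [Complex.sub_re, Complex.smul_re, smul_eq_mul, Complex.I_mul_re, circlePt_re,
      circlePt_im, Real.cos_add, Real.cos_sub]
    ring
  · simp only [Complex.sub_im, Complex.smul_im, smul_eq_mul, Complex.I_mul_im, circlePt_re,
      circlePt_im, Real.sin_add, Real.sin_sub]
    ring

lemma IsConvexPolygon.edgeVec_ne_zero {m : ℕ} {P : Polygon ℂ m} (hP : IsConvexPolygon P)
    (i : Fin m) : edgeVec P i ≠ 0 := by
  intro h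
  obtain ⟨j, hj⟩ : ∃ j, j ∉ ({i, finRotate m i} : Finset (Fin m)) := by
    by_contra! hcon
    have h1 := Finset.card_le_card (fun j _ => hcon j : (Finset.univ : Finset (Fin m)) ⊆ _)
    have h2 := Finset.card_le_two (a := i) (b := finRotate m i)
    have h3 := hP.1
    simp only [Finset.card_univ, Fintype.card_fin] at h1
    omega
  simp only [Finset.mem_insert, Finset.mem_singleton, not_or] at hj
  rcases hP.2 with h' | h' <;>
  · have := h' i j hj.1 hj.2
    simp [h] at this

lemma IsConvexPolygon.injective {m : ℕ} {P : Polygon ℂ m} (hP : IsConvexPolygon P) {i j : Fin m}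
    (hij : j ≠ i) : P j ≠ P i := by
  intro h
  by_cases hj : j = finRotate m i
  · apply hP.edgeVec_ne_zero i
    rw [edgeVec, ← hj, h, sub_self]
  · rcases hP.2 with h' | h' <;>
    · have := h' i j hij hj
      simp [h] at this

lemma isConvexPolygon_circle {m : ℕ} (hm : 3 ≤ m) {θ : ℕ → ℝ} (hθ : StrictMono θ)
    (hper : ∀ i, θ (i + m) = θ i + 2 * Real.pi) (Ψ : ℂ ≃ᵃ[ℝ] ℂ) {P : Polygon ℂ m}
    (hP : ∀ i, P i = Ψ (circlePt (θ i))) : IsConvexPolygon P := by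
  have hsub : ∀ a b, Ψ a - Ψ b = Ψ.linear (a - b) := fun a b => (Ψ.toAffineMap.linearMap_vsub a b).symm
  obtain ⟨d, hd, hdL⟩ := exists_cross_map Ψ.linear
  have hrot : ∀ i, P (finRotate m i) = Ψ (circlePt (θ (i + 1))) := by
    intro i
    rw [hP, val_finRotate]
    rcases Nat.lt_or_ge (i + 1) m with h | h
    · rw [Nat.mod_eq_of_lt h]
    · have : (i : ℕ) + 1 = 0 + m := by omega
      rw [this, Nat.add_mod_right, hper, circlePt_add_two_pi, Nat.zero_mod]
  have key : ∀ x y z : ℝ, x < y → y < z → z < x + 2 * Real.pi →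
      0 < cross (circlePt y - circlePt x) (circlePt z - circlePt x) := by
    intro x y z h1 h2 h3
    rw [cross_circlePt_sub]
    have s1 := Real.sin_pos_of_pos_of_lt_pi (x := (y - x) / 2) (by linarith) (by linarith)
    have s2 := Real.sin_pos_of_pos_of_lt_pi (x := (z - y) / 2) (by linarith) (by linarith)
    have s3 := Real.sin_pos_of_pos_of_lt_pi (x := (z - x) / 2) (by linarith) (by linarith)
    positivity
  have hleft : ∀ i j : Fin m, j ≠ i → j ≠ finRotate m i →
      0 < cross (circlePt (θ (i + 1)) - circlePt (θ i)) (circlePt (θ j) - circlePt (θ i)) := by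
    intro i j h1 h2
    rw [ne_eq, Fin.ext_iff] at h1 h2
    rw [val_finRotate] at h2
    rcases Nat.lt_or_ge i j with h | h
    · rw [Nat.mod_eq_of_lt (by omega)] at h2
      exact key _ _ _ (hθ (by omega)) (hθ (by omega)) (by rw [← hper]; exact hθ (by omega))
    · have h3 : (i : ℕ) + 1 < j + m := by
        by_contra h3
        have : (i : ℕ) + 1 = 0 + m := by omega
        rw [this, Nat.add_mod_right, Nat.zero_mod] at h2
        omega
      -- Here `j` precedes `i`, so it is replaced by its copy one full turn later.
      rw [← circlePt_add_two_pi (θ j), ← hper]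
      exact key _ _ _ (hθ (by omega)) (hθ (by omega)) (by rw [← hper]; exact hθ (by omega))
  have hcross : ∀ i j, (conj (edgeVec P i) * (P j - P i)).im = d *
      cross (circlePt (θ (i + 1)) - circlePt (θ i)) (circlePt (θ j) - circlePt (θ i)) := by
    intro i j
    rw [← hdL, edgeVec, hrot, hP, hP, hsub, hsub]; rfl
  refine ⟨hm, ?_⟩
  rcases hd.lt_or_gt with hd | hd
  · right; intro i j h1 h2
    rw [hcross]; exact mul_neg_of_neg_of_pos hd (hleft i j h1 h2)
  · left; intro i j h1 h2
    rw [hcross]; exact mul_pos hd (hleft i j h1 h2)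

/-! ### The inscribed `2n`-gon with alternating gaps and its chord directions -/

/-- The arguments of the vertices of a `2n`-gon inscribed in the unit circle, with the symmetries
of the regular `n`-gon. -/
def semiAngle (n : ℕ) (α : ℝ) (i : ℕ) : ℝ :=
  2 * Real.pi / n * (i / 2 : ℕ) + if Even i then -α else α

lemma semiAngle_even (n : ℕ) (α : ℝ) (k : ℕ) :
    semiAngle n α (2 * k) = 2 * Real.pi / n * k - α := by
  simp [semiAngle, sub_eq_add_neg]

lemma semiAngle_odd (n : ℕ) (α : ℝ) (k : ℕ) :
    semiAngle n α (2 * k + 1) = 2 * Real.pi / n * k + α := by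
  have : (2 * k + 1) / 2 = k := by omega
  simp [semiAngle, this]

lemma semiAngle_strictMono {n : ℕ} {α : ℝ} (h0 : 0 < α) (h1 : α < Real.pi / n) :
    StrictMono (semiAngle n α) := by
  refine strictMono_nat_of_lt_succ fun i => ?_
  obtain ⟨k, rfl | rfl⟩ := Nat.even_or_odd' i
  · rw [semiAngle_even, semiAngle_odd]; linarith
  · rw [show 2 * k + 1 + 1 = 2 * (k + 1) by ring, semiAngle_even, semiAngle_odd]
    push_cast
    have : 2 * Real.pi / n = 2 * (Real.pi / n) := by ring
    rw [this]; linarith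

lemma semiAngle_add {n : ℕ} (hn : 0 < n) (α : ℝ) (i : ℕ) :
    semiAngle n α (i + (n + n)) = semiAngle n α i + 2 * Real.pi := by
  have : (n : ℝ) ≠ 0 := by positivity
  obtain ⟨k, rfl | rfl⟩ := Nat.even_or_odd' i
  · rw [show 2 * k + (n + n) = 2 * (k + n) by ring, semiAngle_even, semiAngle_even]
    push_cast; field_simp; ring
  · rw [show 2 * k + 1 + (n + n) = 2 * (k + n) + 1 by ring, semiAngle_odd, semiAngle_odd]
    push_cast; field_simp; ring

/-- Indices with odd sum have opposite parity, so the offsets `-α` and `α` cancel. -/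
lemma semiAngle_add_semiAngle (n : ℕ) (α : ℝ) {i j k : ℕ} (h : i + j = 2 * k + 1) :
    (semiAngle n α i + semiAngle n α j) / 2 = Real.pi / n * k := by
  obtain ⟨a, rfl | rfl⟩ := Nat.even_or_odd' i <;> obtain ⟨b, rfl | rfl⟩ := Nat.even_or_odd' j
  · omega
  · obtain rfl : k = a + b := by omega
    rw [semiAngle_even, semiAngle_odd]; push_cast; ring
  · obtain rfl : k = a + b := by omega
    rw [semiAngle_even, semiAngle_odd]; push_cast; ring
  · omega

/-- The chord directions of the polygons inscribed in the unit circle with the symmetries of the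
regular `n`-gon. -/
def chordDir (n k : ℕ) : ℂ := Complex.I * circlePt (Real.pi / n * k)

lemma chordDir_ne_zero (n k : ℕ) : chordDir n k ≠ 0 :=
  mul_ne_zero Complex.I_ne_zero (circlePt_ne_zero _)

lemma chordDir_add {n : ℕ} (hn : 0 < n) (k : ℕ) : chordDir n (k + n) = - chordDir n k := by
  have : (n : ℝ) ≠ 0 := by positivity
  rw [chordDir, chordDir, show Real.pi / n * ((k + n : ℕ) : ℝ) = Real.pi / n * k + Real.pi by
    push_cast; field_simp, circlePt_add_pi, mul_neg]

lemma cross_chordDir_ne_zero {n j k : ℕ} (hjk : j < k) (hk : k < n) :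
    cross (chordDir n j) (chordDir n k) ≠ 0 := by
  have h1 : cross (chordDir n j) (chordDir n k) = Real.sin (Real.pi / n * (k - j)) := by
    have : cross (chordDir n j) (chordDir n k) =
        cross (circlePt (Real.pi / n * j)) (circlePt (Real.pi / n * k)) := by
      simp [chordDir, cross_eq]; ring
    rw [this, cross_circlePt]; congr 1; ring
  rw [h1]
  have hn : (0 : ℝ) < n := by exact_mod_cast (by omega : 0 < n)
  have h2 : (j : ℝ) < k := by exact_mod_cast hjk
  have h3 : (k : ℝ) < n := by exact_mod_cast hk
  have h4 : (0 : ℝ) ≤ j := by positivity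
  refine (Real.sin_pos_of_pos_of_lt_pi (mul_pos (by positivity) (by linarith)) ?_).ne'
  rw [div_mul_eq_mul_div, div_lt_iff₀ hn]
  nlinarith [Real.pi_pos]

/-- The normalized images of the chord directions under a linear map. -/
def chordDirSet (n : ℕ) (L : ℂ ≃ₗ[ℝ] ℂ) : Finset ℂ :=
  (Finset.range n).image fun k => ‖L (chordDir n k)‖⁻¹ • L (chordDir n k)

lemma mem_chordDirSet {n : ℕ} {L : ℂ ≃ₗ[ℝ] ℂ} {u : ℂ} (hu : u ∈ chordDirSet n L) :
    ‖u‖ = 1 ∧ ∃ k < n, ∃ r : ℝ, r ≠ 0 ∧ L (chordDir n k) = r • u := by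
  obtain ⟨k, hk, rfl⟩ := Finset.mem_image.mp hu
  have h0 : L (chordDir n k) ≠ 0 := by simpa using chordDir_ne_zero n k
  have h1 : ‖L (chordDir n k)‖ ≠ 0 := norm_ne_zero_iff.mpr h0
  refine ⟨by rw [norm_smul, norm_inv, norm_norm, inv_mul_cancel₀ h1], k, Finset.mem_range.mp hk,
    _, h1, by rw [smul_inv_smul₀ h1]⟩

lemma exists_mem_chordDirSet {n : ℕ} (L : ℂ ≃ₗ[ℝ] ℂ) {k : ℕ} (hk : k < n) :
    ∃ u ∈ chordDirSet n L, ∃ r : ℝ, L (chordDir n k) = r • u :=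
  ⟨_, Finset.mem_image_of_mem _ (Finset.mem_range.mpr hk), ‖L (chordDir n k)‖, by
    rw [smul_inv_smul₀]
    simpa using chordDir_ne_zero n k⟩

lemma chordDir_eq_of_cross {n : ℕ} {L : ℂ ≃ₗ[ℝ] ℂ} {j k : ℕ} (hj : j < n) (hk : k < n)
    (h : cross (L (chordDir n j)) (L (chordDir n k)) = 0) : j = k := by
  obtain ⟨d, hd, hdL⟩ := exists_cross_map L
  rw [hdL] at h
  have h := (mul_eq_zero.mp h).resolve_left hd
  rcases lt_trichotomy j k with hjk | hjk | hjk
  · exact absurd h (cross_chordDir_ne_zero hjk hk)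
  · exact hjk
  · refine absurd ?_ (cross_chordDir_ne_zero hjk hj)
    rw [cross_eq] at h ⊢; linarith

lemma card_chordDirSet (n : ℕ) (L : ℂ ≃ₗ[ℝ] ℂ) : (chordDirSet n L).card = n := by
  rw [chordDirSet, Finset.card_image_of_injOn, Finset.card_range]
  intro j hj k hk h
  simp only at h
  have h0 : ‖L (chordDir n j)‖ ≠ 0 := by simpa using chordDir_ne_zero n j
  refine chordDir_eq_of_cross (L := L) (Finset.mem_range.mp hj) (Finset.mem_range.mp hk) ?_
  have h1 : L (chordDir n j) = ‖L (chordDir n j)‖ • (‖L (chordDir n k)‖⁻¹ • L (chordDir n k)) := by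
    rw [← h, smul_inv_smul₀ h0]
  rw [h1, cross_smul_left, cross_smul_left]
  simp [cross_eq, mul_comm]

lemma isDirectionSet_chordDirSet (n : ℕ) (L : ℂ ≃ₗ[ℝ] ℂ) : IsDirectionSet (chordDirSet n L) := by
  refine ⟨fun u hu => (mem_chordDirSet hu).1, fun u hu v hv huv hpar => huv ?_⟩
  obtain ⟨j, hj, rfl⟩ := Finset.mem_image.mp hu
  obtain ⟨k, hk, rfl⟩ := Finset.mem_image.mp hv
  have h1 := hpar.cross_eq_zero
  rw [cross_smul_left, cross_smul_right] at h1
  have a1 : ‖L (chordDir n j)‖ ≠ 0 := by simpa using chordDir_ne_zero n j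
  have a2 : ‖L (chordDir n k)‖ ≠ 0 := by simpa using chordDir_ne_zero n k
  have h2 := (mul_eq_zero.mp ((mul_eq_zero.mp h1).resolve_left (inv_ne_zero a1))).resolve_left
    (inv_ne_zero a2)
  rw [chordDir_eq_of_cross (Finset.mem_range.mp hj) (Finset.mem_range.mp hk) h2]

/-- The affine image of an inscribed `2n`-gon with the symmetries of the regular `n`-gon. -/
def semiPolygon (n : ℕ) (α : ℝ) (Ψ : ℂ ≃ᵃ[ℝ] ℂ) : Polygon ℂ (n + n) :=
  ⟨fun i => Ψ (circlePt (semiAngle n α i))⟩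

/-- A chord between indices with sum `2k + 1` modulo `2n` has direction `chordDir n k`, whatever `α`
is. This covers every edge, and all `n` such directions at every vertex; the class is thus limited
only by the cardinality of the direction set. -/
lemma semiPolygon_isOfClass {n : ℕ} (hn : 2 ≤ n) {α : ℝ} (h0 : 0 < α) (h1 : α < Real.pi / n)
    (Ψ : ℂ ≃ᵃ[ℝ] ℂ) : IsOfClass (chordDirSet n Ψ.linear) (semiPolygon n α Ψ) n := by
  have hconv : IsConvexPolygon (semiPolygon n α Ψ) :=
    isConvexPolygon_circle (by omega) (semiAngle_strictMono h0 h1) (semiAngle_add (by omega) α) Ψ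
      fun _ => rfl
  have hsub : ∀ a b, Ψ a - Ψ b = Ψ.linear (a - b) := fun a b => (Ψ.toAffineMap.linearMap_vsub a b).symm
  have hchord : ∀ i j k : ℕ, i + j = 2 * k + 1 → ∃ r : ℝ,
      Ψ (circlePt (semiAngle n α j)) - Ψ (circlePt (semiAngle n α i)) =
        r • Ψ.linear (chordDir n k) := by
    intro i j k h
    refine ⟨2 * Real.sin ((semiAngle n α j - semiAngle n α i) / 2), ?_⟩
    rw [hsub, circlePt_sub, map_smul, semiAngle_add_semiAngle n α (by omega : j + i = 2 * k + 1)]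
    rfl
  have hdir : ∀ i j : ℕ, ∀ k < n, (i + j = 2 * k + 1 ∨ i + j = 2 * (k + n) + 1) → ∃ r : ℝ,
      Ψ (circlePt (semiAngle n α j)) - Ψ (circlePt (semiAngle n α i)) =
        r • Ψ.linear (chordDir n k) := by
    rintro i j k - (h | h)
    · exact hchord i j k h
    · obtain ⟨r, hr⟩ := hchord i j (k + n) h
      exact ⟨-r, by rw [hr, chordDir_add (by omega), map_neg, smul_neg, neg_smul]⟩
  have hrun : ∀ i, ∃ u ∈ chordDirSet n Ψ.linear, Parallel u (edgeVec (semiPolygon n α Ψ) i) := by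
    intro i
    have hi := i.2
    have hlast : semiPolygon n α Ψ (finRotate _ i) = Ψ (circlePt (semiAngle n α (i + 1))) := by
      change Ψ (circlePt (semiAngle n α (finRotate (n + n) i : Fin (n + n)))) = _
      rw [val_finRotate]
      rcases Nat.lt_or_ge (i + 1) (n + n) with h | h
      · rw [Nat.mod_eq_of_lt h]
      · have : (i : ℕ) + 1 = 0 + (n + n) := by omega
        rw [this, Nat.add_mod_right, semiAngle_add (by omega), circlePt_add_two_pi, Nat.zero_mod]
    obtain ⟨k, hk, hik⟩ : ∃ k < n, (i : ℕ) = k ∨ (i : ℕ) = k + n := by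
      rcases Nat.lt_or_ge i n with h | h
      · exact ⟨i, h, Or.inl rfl⟩
      · exact ⟨i - n, by omega, Or.inr (by omega)⟩
    obtain ⟨r, hr⟩ := hdir i (i + 1) k hk (by omega)
    obtain ⟨u, hu, s, hs⟩ := exists_mem_chordDirSet Ψ.linear hk
    have he : edgeVec (semiPolygon n α Ψ) i = (r * s) • u := by
      rw [mul_smul, ← hs, ← hr, edgeVec, hlast]; rfl
    refine ⟨u, hu, r * s, fun h => hconv.edgeVec_ne_zero i ?_, he⟩
    rw [he, h, zero_smul]
  refine ⟨⟨isDirectionSet_chordDirSet _ _, hconv, ?_⟩, ⟨by omega, (card_chordDirSet _ _).ge,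
    ⟨0, by omega⟩, fun j _ => hrun _⟩, fun k hk => hk.2.1.trans (card_chordDirSet _ _).le⟩
  intro u hu i
  have hi := i.2
  obtain ⟨-, k, hk, s, -, hs⟩ := mem_chordDirSet hu
  -- The partner of `i` is `2k + 1 - i` modulo `2n`; it differs from `i` by parity.
  obtain ⟨j, hj, hjk⟩ : ∃ j < n + n, (i : ℕ) + j = 2 * k + 1 ∨ (i : ℕ) + j = 2 * (k + n) + 1 := by
    rcases Nat.lt_or_ge (2 * k + 1) i with h | h
    · exact ⟨2 * (k + n) + 1 - i, by omega, by omega⟩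
    · exact ⟨2 * k + 1 - i, by omega, by omega⟩
  obtain ⟨r, hr⟩ := hdir i j k hk hjk
  refine ⟨⟨j, hj⟩, hconv.injective ?_, r * s, ?_⟩
  · rw [ne_eq, Fin.ext_iff]; simp only; omega
  · rw [mul_smul, ← hs, ← hr]
    exact (add_sub_cancel _ _).symm

/-! ### From the field inclusion to polygons in `Λ` -/

lemma zeta_pow_self {n : ℕ} (hn : n ≠ 0) : zeta n ^ n = 1 :=
  (Complex.isPrimitiveRoot_exp n hn).pow_eq_one

lemma zeta_mul_conj (n : ℕ) : zeta n * conj (zeta n) = 1 := by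
  rw [Complex.mul_conj, zeta_eq, Complex.normSq_eq_norm_sq, Complex.norm_exp_ofReal_mul_I]; simp

lemma zeta_im_pos {n : ℕ} (hn : 3 ≤ n) : 0 < (zeta n).im := by
  rw [zeta_eq_circlePt, circlePt_im]
  refine Real.sin_pos_of_pos_of_lt_pi (by positivity) ?_
  have h : (3 : ℝ) ≤ n := by exact_mod_cast hn
  rw [div_lt_iff₀ (by positivity)]
  nlinarith [Real.pi_pos]

lemma zeta_mul_left {n d : ℕ} (hd : d ≠ 0) : zeta (d * n) ^ d = zeta n := by
  rw [zeta, zeta, ← Complex.exp_nat_mul]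
  congr 1
  have : (d : ℂ) ≠ 0 := by exact_mod_cast hd
  rcases eq_or_ne n 0 with rfl | hn
  · simp
  have : (n : ℂ) ≠ 0 := by exact_mod_cast hn
  push_cast; field_simp

/-- The linear map fixing `1` and sending `I` to `τ`. -/
def shearEquiv (τ : ℂ) (hτ : τ.im ≠ 0) : ℂ ≃ₗ[ℝ] ℂ where
  toFun z := z.re • (1 : ℂ) + z.im • τ
  map_add' a b := by simp only [Complex.add_re, Complex.add_im]; module
  map_smul' r a := by
    simp only [Complex.smul_re, Complex.smul_im, smul_eq_mul, RingHom.id_apply]; module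
  invFun z := ⟨z.re - z.im / τ.im * τ.re, z.im / τ.im⟩
  left_inv z := by apply Complex.ext <;> simp [hτ]
  right_inv z := by apply Complex.ext <;> simp [hτ]

lemma shearEquiv_one (τ : ℂ) (hτ : τ.im ≠ 0) : shearEquiv τ hτ 1 = 1 := by
  change (1 : ℂ).re • (1 : ℂ) + (1 : ℂ).im • τ = 1
  simp

lemma shearEquiv_I (τ : ℂ) (hτ : τ.im ≠ 0) : shearEquiv τ hτ Complex.I = τ := by
  change Complex.I.re • (1 : ℂ) + Complex.I.im • τ = τ
  simp

lemma exists_im_ne_zero {Λ : Set ℂ} (hΛ : ¬ Degenerate Λ) : ∃ τ ∈ fieldK Λ, τ.im ≠ 0 := by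
  by_contra! h
  exact hΛ fun z hz => mem_realField_iff.mpr (h z hz)

/-- A linear image of the `n`-th roots of unity with entries in the field of `Λ`. -/
lemma exists_linearEquiv {Λ : Set ℂ} (hΛ : ¬ Degenerate Λ) {n : ℕ} (hn : 3 ≤ n)
    (h : cycloReal n ≤ fieldk Λ) :
    ∃ Φ : ℂ ≃ₗ[ℝ] ℂ, ∀ k : ℕ, Φ (zeta n ^ k) ∈ fieldK Λ := by
  obtain ⟨τ, hτ, hτ0⟩ := exists_im_ne_zero hΛ
  have hz := (zeta_im_pos hn).ne'
  let Φ := (shearEquiv (zeta n) hz).symm.trans (shearEquiv τ hτ0)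
  have h1 : Φ 1 = 1 := by
    simp only [Φ, LinearEquiv.trans_apply]
    rw [(LinearEquiv.symm_apply_eq _).mpr (shearEquiv_one _ hz).symm, shearEquiv_one]
  have h2 : Φ (zeta n) = τ := by
    simp only [Φ, LinearEquiv.trans_apply]
    rw [(LinearEquiv.symm_apply_eq _).mpr (shearEquiv_I _ hz).symm, shearEquiv_I]
  rw [cycloReal_le_fieldk_iff] at h
  refine ⟨Φ, fun k => ?_⟩
  induction k using Nat.twoStepInduction with
  | zero => rw [pow_zero, h1]; exact one_mem _
  | one => rw [pow_one, h2]; exact hτ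
  | more k ih1 ih2 =>
    -- The coefficients of this recurrence are real, so `Φ` preserves it, and they lie in the field;
    -- the values `1` and `τ` start it.
    have : zeta n ^ (k + 2) =
        (2 * Real.cos (2 * Real.pi / n)) • zeta n ^ (k + 1) - zeta n ^ k := by
      rw [Complex.real_smul, ← zeta_add_conj]
      linear_combination (-zeta n ^ k) * zeta_mul_conj n
    rw [this, map_sub, map_smul, Complex.real_smul]
    exact sub_mem (mul_mem h ih2) ih1

lemma PropAff.exists_affineEquiv {Λ : Set ℂ} (hAff : PropAff Λ) (Φ : ℂ ≃ₗ[ℝ] ℂ) {m : ℕ}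
    {p : Fin m → ℂ} (hp : ∀ i, Φ (p i) ∈ fieldK Λ) : ∃ Ψ : ℂ ≃ᵃ[ℝ] ℂ, ∀ i, Ψ (p i) ∈ Λ := by
  obtain ⟨Ψ, hΨ⟩ := hAff (Set.range fun i => Φ (p i)) (Set.finite_range _)
    (by rintro _ ⟨i, rfl⟩; exact hp i)
  exact ⟨Φ.toAffineEquiv.trans Ψ, fun i => hΨ ⟨_, ⟨i, rfl⟩, rfl⟩⟩

/-- The freedom in `α` is used to make the vertices, up to a common factor, rational combinations of
`n`-th roots of unity; no larger cyclotomic field is then needed. -/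
lemma exists_semiPolygon {Λ : Set ℂ} (hΛ : ¬ Degenerate Λ) (hAff : PropAff Λ) {n : ℕ} (hn : 3 ≤ n)
    (h : cycloReal n ≤ fieldk Λ) : ∃ (α : ℝ) (Ψ : ℂ ≃ᵃ[ℝ] ℂ), 0 < α ∧ α < Real.pi / n ∧
      VerticesIn (semiPolygon n α Ψ) Λ := by
  obtain ⟨Φ, hΦ⟩ := exists_linearEquiv hΛ hn h
  have hn3 : (3 : ℝ) ≤ n := by exact_mod_cast hn
  -- With `tan α = t`, the points `1 ± i tan α` are `1 ± (ζ - conj ζ)/4`. The bound `α < π/n` comes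
  -- from `sin x cos x < tan x` at `x = π/n`.
  set t : ℝ := Real.sin (2 * Real.pi / n) / 2 with ht
  have hx0 : 0 < Real.pi / n := by positivity
  have hx1 : Real.pi / n < Real.pi / 2 := by
    refine div_lt_div_of_pos_left Real.pi_pos two_pos (by linarith)
  have ht0 : 0 < t := by
    have := zeta_im_pos hn
    rw [zeta_eq_circlePt, circlePt_im] at this
    positivity
  have ht1 : t < Real.tan (Real.pi / n) := by
    have hs := Real.sin_pos_of_pos_of_lt_pi hx0 (by linarith)
    have hc := Real.cos_pos_of_mem_Ioo (x := Real.pi / n) ⟨by linarith, hx1⟩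
    rw [ht, mul_div_assoc, Real.sin_two_mul, Real.tan_eq_sin_div_cos, lt_div_iff₀ hc]
    nlinarith [Real.sin_sq_add_cos_sq (Real.pi / n), mul_pos hs (mul_pos hs hs)]
  have hα0 : 0 < Real.arctan t := Real.arctan_pos.mpr ht0
  have hα1 : Real.arctan t < Real.pi / n := by
    rw [← Real.arctan_tan (x := Real.pi / n) (by linarith) hx1]
    exact Real.arctan_strictMono ht1
  -- `R = 1 / cos α` scales the unit circle so that its points of argument `±α` become `1 ± i tan
  -- α`.
  set R : ℝ := Real.sqrt (1 + t ^ 2) with hR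
  have hR0 : R ≠ 0 := (Real.sqrt_pos.mpr (by positivity)).ne'
  have hconj : zeta n - conj (zeta n) = (4 * t : ℝ) * Complex.I := by
    rw [Complex.sub_conj, zeta_eq_circlePt, circlePt_im, ht]; push_cast; ring
  have hplus : R * circlePt (Real.arctan t) = 1 + (1 / 4 : ℝ) * (zeta n - conj (zeta n)) := by
    rw [hconj]
    apply Complex.ext
    · simp [circlePt_re, Real.cos_arctan, ← hR, hR0]
    · simp [circlePt_im, Real.sin_arctan, ← hR]; field_simp
  have hminus : R * circlePt (-Real.arctan t) = 1 - (1 / 4 : ℝ) * (zeta n - conj (zeta n)) := by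
    rw [hconj]
    apply Complex.ext
    · simp [circlePt_re, Real.cos_arctan, ← hR, hR0]
    · simp [circlePt_im, Real.sin_arctan, ← hR]; field_simp
  have hpow : ∀ k : ℕ, circlePt (2 * Real.pi / n * k) = zeta n ^ k := by
    intro k; rw [mul_comm, circlePt_nat_mul, zeta_eq_circlePt]
  have hconjpow : ∀ k : ℕ, zeta n ^ k * conj (zeta n) = zeta n ^ (k + (n - 1)) := by
    intro k
    have h1 : zeta n ^ (n - 1) * zeta n = 1 := by
      rw [← pow_succ, Nat.sub_add_cancel (by omega), zeta_pow_self (by omega)]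
    rw [pow_add]
    linear_combination (-zeta n ^ k * conj (zeta n)) * h1
      + (zeta n ^ k * zeta n ^ (n - 1)) * zeta_mul_conj n
  have hmem : ∀ (k : ℕ) (q : ℚ), Φ (zeta n ^ k *
      (1 + ((q : ℝ) : ℂ) * (zeta n - conj (zeta n)))) ∈ fieldK Λ := by
    intro k q
    have : zeta n ^ k * (1 + ((q : ℝ) : ℂ) * (zeta n - conj (zeta n))) =
        zeta n ^ k + (q : ℝ) • (zeta n ^ (k + 1) - zeta n ^ (k + (n - 1))) := by
      rw [← hconjpow, Complex.real_smul]; ring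
    rw [this, map_add, map_smul, map_sub, Complex.real_smul]
    exact add_mem (hΦ _) (mul_mem (by simp)
      (sub_mem (hΦ _) (hΦ _)))
  obtain ⟨Ψ, hΨ⟩ := hAff.exists_affineEquiv
    ((LinearEquiv.smulOfNeZero ℝ ℂ R hR0).trans Φ) (m := n + n)
    (p := fun i => circlePt (semiAngle n (Real.arctan t) i)) (by
      intro i
      rw [LinearEquiv.trans_apply, LinearEquiv.smulOfNeZero_apply, Complex.real_smul]
      obtain ⟨k, hk | hk⟩ := Nat.even_or_odd' (i : ℕ)
      · rw [hk, semiAngle_even, sub_eq_add_neg, circlePt_add, hpow, mul_left_comm, hminus]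
        have := hmem k (-1 / 4)
        convert this using 4
        push_cast; ring
      · rw [hk, semiAngle_odd, circlePt_add, hpow, mul_left_comm, hplus]
        have := hmem k (1 / 4)
        convert this using 5
        push_cast; ring)
  exact ⟨_, Ψ, hα0, hα1, hΨ⟩

lemma IsUPolygon.isLambdaDirection {Λ : Set ℂ} {m : ℕ} {U : Finset ℂ} {P : Polygon ℂ m}
    (hP : IsUPolygon U P) (hPΛ : VerticesIn P Λ) {u : ℂ} (hu : u ∈ U) : IsLambdaDirection Λ u := by
  obtain ⟨j, hj, t, ht⟩ := hP.2.2 u hu ⟨0, by have := hP.2.1.1; omega⟩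
  refine ⟨hP.1.1 u hu, _, Set.sub_mem_sub (hPΛ j) (hPΛ ⟨0, by have := hP.2.1.1; omega⟩),
    sub_ne_zero.mpr hj, t, ?_, by rw [ht, add_sub_cancel_left]⟩
  rintro rfl
  exact hj (by rw [ht, zero_smul, add_zero])

/-- For this `α` the gaps `2α` and `2π/n - 2α` are equal. -/
lemma isAffinelyRegular_semiPolygon {n : ℕ} (hn : 2 ≤ n) (Ψ : ℂ ≃ᵃ[ℝ] ℂ) :
    IsAffinelyRegular (semiPolygon n (Real.pi / (2 * n)) Ψ) := by
  refine ⟨⟨fun k => 0 + circlePt (-(Real.pi / (2 * n))) * zeta (n + n) ^ (k : ℕ)⟩, Ψ,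
    ⟨by omega, 0, _, circlePt_ne_zero _, fun _ => rfl⟩, fun k => ?_⟩
  change Ψ _ = Ψ (0 + circlePt (-(Real.pi / (2 * n))) * zeta (n + n) ^ (k : ℕ))
  rw [zero_add, zeta_eq_circlePt, ← circlePt_nat_mul, ← circlePt_add]
  congr 2
  have : (n : ℝ) ≠ 0 := by positivity
  obtain ⟨j, hj | hj⟩ := Nat.even_or_odd' (k : ℕ)
  · rw [hj, semiAngle_even]; push_cast; field_simp; ring
  · rw [hj, semiAngle_odd]; push_cast; field_simp; ring

lemma hasUPolygonIn_of_cycloReal_le {Λ : Set ℂ} (hΛ : ¬ Degenerate Λ) (hAff : PropAff Λ) {n : ℕ}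
    (hn : 4 ≤ n) (h : cycloReal n ≤ fieldk Λ) : HasUPolygonIn Λ (n + n) := by
  obtain ⟨α, Ψ, h0, h1, hv⟩ := exists_semiPolygon hΛ hAff (by omega) h
  exact ⟨_, _, n, hn, semiPolygon_isOfClass (by omega) h0 h1 Ψ, hv⟩

/-- The direction set depends on `Ψ` but not on `α`: it consists of `Λ`-directions because of the
polygon in `Λ`, and then serves the affinely regular polygon. -/
lemma hasAffinelyRegularUPolygon_of_cycloReal_le {Λ : Set ℂ} (hΛ : ¬ Degenerate Λ)
    (hAff : PropAff Λ) {n : ℕ} (hn : 4 ≤ n) (h : cycloReal n ≤ fieldk Λ) :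
    HasAffinelyRegularUPolygon Λ (n + n) := by
  obtain ⟨α, Ψ, h0, h1, hv⟩ := exists_semiPolygon hΛ hAff (by omega) h
  have hn0 : (0 : ℝ) < n := by positivity
  refine ⟨_, _, n, fun u hu => ?_, hn,
    semiPolygon_isOfClass (by omega) (α := Real.pi / (2 * n)) (by positivity) ?_ Ψ,
    isAffinelyRegular_semiPolygon (by omega) Ψ⟩
  · exact (semiPolygon_isOfClass (by omega) h0 h1 Ψ).1.isLambdaDirection hv hu
  · exact div_lt_div_of_pos_left Real.pi_pos hn0 (by linarith)

/-! ### Affinely regular polygons in `Λ` -/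

lemma lcm_two_cases (n : ℕ) : Nat.lcm n 2 = n ∨ Odd n ∧ Nat.lcm n 2 = 2 * n := by
  rcases Nat.even_or_odd n with h | h
  · exact Or.inl (Nat.lcm_eq_left h.two_dvd)
  · refine Or.inr ⟨h, ?_⟩
    rw [Nat.Coprime.lcm_eq_mul (Nat.coprime_two_right.mpr h), mul_comm]

lemma hasAffinelyRegularIn_of_cycloReal_le {Λ : Set ℂ} (hΛ : ¬ Degenerate Λ) (hAff : PropAff Λ)
    {n : ℕ} (hn : 3 ≤ n) (h : cycloReal n ≤ fieldk Λ) :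
    HasAffinelyRegularIn Λ (Nat.lcm n 2) := by
  obtain ⟨Φ, hΦ⟩ := exists_linearEquiv hΛ hn h
  have hmem : ∀ k : ℕ, Φ (zeta (Nat.lcm n 2) ^ k) ∈ fieldK Λ := by
    intro k
    rcases lcm_two_cases n with hl | ⟨hodd, hl⟩
    · rw [hl]; exact hΦ k
    · rw [hl]
      have hz := zeta_mul_left (n := n) (d := 2) two_ne_zero
      have hneg : zeta (2 * n) ^ n = -1 := by
        rw [zeta_eq_circlePt, ← circlePt_nat_mul,
          show (n : ℝ) * (2 * Real.pi / (2 * n : ℕ)) = 0 + Real.pi by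
            have : (n : ℝ) ≠ 0 := by positivity
            push_cast; field_simp; ring, circlePt_add_pi]
        simp [circlePt]
      obtain ⟨b, hb⟩ := hodd
      obtain ⟨a, rfl | rfl⟩ := Nat.even_or_odd' k
      · rw [pow_mul, hz]; exact hΦ a
      -- For odd `n` every `2n`-th root of unity is, up to sign, an `n`-th root of unity.
      · have : zeta (2 * n) ^ (2 * a + 1) = - zeta n ^ (a + b + 1) := by
          have e : 2 * (a + b + 1) = 2 * a + 1 + n := by omega
          rw [← hz, ← pow_mul, e, pow_add _ _ n, hneg]; ring
        rw [this, map_neg]; exact neg_mem (hΦ _)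
  obtain ⟨Ψ, hΨ⟩ := hAff.exists_affineEquiv Φ (m := Nat.lcm n 2)
    (p := fun i => 0 + 1 * zeta (Nat.lcm n 2) ^ (i : ℕ)) (fun i => by
      rw [zero_add, one_mul]; exact hmem i)
  have h3 : 3 ≤ Nat.lcm n 2 := by rcases lcm_two_cases n with hl | ⟨-, hl⟩ <;> omega
  exact ⟨⟨fun i => Ψ (0 + 1 * zeta (Nat.lcm n 2) ^ (i : ℕ))⟩,
    ⟨⟨fun i => 0 + 1 * zeta (Nat.lcm n 2) ^ (i : ℕ)⟩, Ψ, ⟨h3, 0, 1, one_ne_zero, fun _ => rfl⟩,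
      fun _ => rfl⟩, hΨ⟩

/-- The diagonal from vertex `0` to vertex `3` is parallel to the edge from `1` to `2`. Their ratio
`1 + 2 cos (2π/N)` is affinely invariant and is a quotient of elements of `Λ - Λ`. -/
lemma two_cos_mem_of_hasAffinelyRegularIn {Λ : Set ℂ} {N : ℕ} (hN : 4 ≤ N)
    (h : HasAffinelyRegularIn Λ N) : ((2 * Real.cos (2 * Real.pi / N) : ℝ) : ℂ) ∈ fieldK Λ := by
  obtain ⟨P, ⟨Q, Ψ, ⟨-, c, r, hr, hQ⟩, hP⟩, hΛ⟩ := h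
  have hsub : ∀ i j, P i - P j = Ψ.linear (Q i - Q j) := fun i j => by
    rw [hP, hP]; exact (Ψ.toAffineMap.linearMap_vsub _ _).symm
  have hz1 : zeta N ≠ 1 := fun h1 => by
    have := zeta_im_pos (n := N) (by omega)
    rw [h1] at this; simp at this
  have hz0 : zeta N ≠ 0 := Complex.exp_ne_zero _
  have hne : P ⟨2, by omega⟩ - P ⟨1, by omega⟩ ≠ 0 := by
    rw [hsub, ne_eq, LinearEquiv.map_eq_zero_iff, hQ, hQ]
    have : c + r * zeta N ^ 2 - (c + r * zeta N ^ 1) = r * (zeta N * (zeta N - 1)) := by ring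
    rw [this]
    exact mul_ne_zero hr (mul_ne_zero hz0 (sub_ne_zero.mpr hz1))
  have hrel : P ⟨3, by omega⟩ - P ⟨0, by omega⟩ =
      (1 + 2 * Real.cos (2 * Real.pi / N)) • (P ⟨2, by omega⟩ - P ⟨1, by omega⟩) := by
    rw [hsub, hsub, ← map_smul]
    congr 1
    rw [hQ, hQ, hQ, hQ, Complex.real_smul, Complex.ofReal_add, Complex.ofReal_one, ← zeta_add_conj]
    linear_combination (-r * (zeta N - 1)) * zeta_mul_conj N
  have h1 := sub_mem (div_mem (subset_fieldK Λ (Set.sub_mem_sub (hΛ ⟨3, by omega⟩)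
    (hΛ ⟨0, by omega⟩))) (subset_fieldK Λ (Set.sub_mem_sub (hΛ ⟨2, by omega⟩)
    (hΛ ⟨1, by omega⟩)))) (one_mem (fieldK Λ))
  convert h1 using 1
  rw [hrel, Complex.real_smul, mul_div_cancel_right₀ _ hne]
  push_cast; ring

lemma cycloReal_le_of_hasAffinelyRegularIn {Λ : Set ℂ} {n : ℕ} (hn : 4 ≤ n)
    (h : HasAffinelyRegularIn Λ (Nat.lcm n 2)) : cycloReal n ≤ fieldk Λ := by
  rw [cycloReal_le_fieldk_iff]
  rcases lcm_two_cases n with hl | ⟨-, hl⟩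
  · rw [hl] at h; exact two_cos_mem_of_hasAffinelyRegularIn hn h
  · rw [hl] at h
    have h1 := two_cos_mem_of_hasAffinelyRegularIn (by omega) h
    -- Doubling the angle `2π/(2n)`: `2 cos 2θ = (2 cos θ)² - 2`.
    have h2 := sub_mem (mul_mem h1 h1) (natCast_mem (fieldK Λ) 2)
    convert h2 using 1
    have hn0 : (n : ℝ) ≠ 0 := by positivity
    rw [show 2 * Real.pi / n = 2 * (2 * Real.pi / (2 * n : ℕ)) by push_cast; field_simp,
      Real.cos_two_mul]
    push_cast; ring

/-! ### Finiteness under (Alg) -/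

/-- A natural number is bounded in terms of its totient. -/
lemma dvd_factorial_of_totient_le {n C : ℕ} (hn : 0 < n) (h : n.totient ≤ C) :
    n ∣ (2 * C).factorial := by
  rw [Nat.dvd_iff_prime_pow_dvd_dvd]
  intro p k hp hk
  have h1 : (p ^ k).totient ≤ C :=
    (Nat.le_of_dvd (Nat.totient_pos.mpr hn) (Nat.totient_dvd_of_dvd hk)).trans h
  refine Nat.dvd_factorial (pow_pos hp.pos _) ?_
  rcases k with - | k
  · have : (0 : ℕ) < C := (Nat.totient_pos.mpr hn).trans_le h
    simp; omega
  · rw [Nat.totient_prime_pow_succ hp] at h1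
    -- A prime power is at most twice its totient, hence at most `2C`, and so occurs among the
    -- factors of `(2C)!`.
    have h2 : p ≤ 2 * (p - 1) := by have := hp.two_le; omega
    calc p ^ (k + 1) = p ^ k * p := pow_succ _ _
      _ ≤ p ^ k * (2 * (p - 1)) := Nat.mul_le_mul_left _ h2
      _ = 2 * (p ^ k * (p - 1)) := by ring
      _ ≤ 2 * C := by omega

/-- Over the field of `Λ`, `ζ_n` is a root of `X² - (ζ_n + conj ζ_n) X + 1`, so adjoining it at most
doubles the degree, whereas its degree over `ℚ` is `φ(n)`. -/
lemma totient_le_of_cycloReal_le {Λ : Set ℂ} (hAlg : PropAlg Λ) {n : ℕ} (hn : 0 < n)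
    (h : cycloReal n ≤ fieldk Λ) : n.totient ≤ Module.finrank ℚ (fieldK Λ) * 2 := by
  have : FiniteDimensional ℚ (fieldK Λ) := hAlg
  have hc : zeta n + conj (zeta n) ∈ fieldK Λ := by
    rw [zeta_add_conj]; exact cycloReal_le_fieldk_iff.mp h
  set K := fieldK Λ
  let q : Polynomial K := .X ^ 2 - .C ⟨_, hc⟩ * .X + .C 1
  have hqm : q.Monic := by simp only [q]; monicity!
  have hqd : q.natDegree = 2 := by simp only [q]; compute_degree!
  have hq0 : Polynomial.aeval (zeta n) q = 0 := by
    have h1 : algebraMap K ℂ ⟨_, hc⟩ = zeta n + conj (zeta n) := rfl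
    simp only [q, map_add, map_sub, map_mul, map_pow, Polynomial.aeval_X, Polynomial.aeval_C,
      map_one, h1]
    linear_combination -zeta_mul_conj n
  have hint : IsIntegral K (zeta n) := ⟨q, hqm, hq0⟩
  let L := IntermediateField.adjoin K {zeta n}
  have hL : Module.finrank K L ≤ 2 := by
    rw [IntermediateField.adjoin.finrank hint, ← hqd]
    exact Polynomial.natDegree_le_natDegree (minpoly.min K _ hqm hq0)
  have : FiniteDimensional K L := IntermediateField.adjoin.finiteDimensional hint
  have : FiniteDimensional ℚ L := FiniteDimensional.trans ℚ K L
  let z : L := IntermediateField.AdjoinSimple.gen K (zeta n)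
  have hprim := Complex.isPrimitiveRoot_exp n hn.ne'
  have : NeZero (n : ℚ) := ⟨by exact_mod_cast hn.ne'⟩
  have hmin := hprim.minpoly_eq_cyclotomic_of_irreducible
    (Polynomial.cyclotomic.irreducible_rat hn)
  have hz : minpoly ℚ z = minpoly ℚ (zeta n) :=
    (minpoly.algebraMap_eq (algebraMap L ℂ).injective z).symm
  calc n.totient = (minpoly ℚ z).natDegree := by
        rw [hz, ← Polynomial.natDegree_cyclotomic n ℚ, hmin]; rfl
    _ ≤ Module.finrank ℚ L := minpoly.natDegree_le z
    _ = Module.finrank ℚ K * Module.finrank K L := (Module.finrank_mul_finrank ℚ K L).symm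
    _ ≤ _ := Nat.mul_le_mul_left _ hL

lemma tfae_of_four_le {Λ : Set ℂ} (hΛ : ¬ Degenerate Λ) (hAff : PropAff Λ) {n : ℕ} (hn : 4 ≤ n) :
    List.TFAE [HasUPolygonIn Λ (n + n), HasAffinelyRegularUPolygon Λ (n + n),
      cycloReal n ≤ fieldk Λ, HasAffinelyRegularIn Λ (Nat.lcm n 2)] := by
  tfae_have 1 → 3
  | ⟨U, P, c, hc, hP, hPΛ⟩ =>
    cycloReal_le_of_class (by omega) hc hP fun _ hu => hP.1.isLambdaDirection hPΛ hu
  tfae_have 2 → 3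
  | ⟨U, P, c, hU, hc, hP, _⟩ => cycloReal_le_of_class (by omega) hc hP hU
  tfae_have 3 → 1 := hasUPolygonIn_of_cycloReal_le hΛ hAff hn
  tfae_have 3 → 2 := hasAffinelyRegularUPolygon_of_cycloReal_le hΛ hAff hn
  tfae_have 3 → 4 := hasAffinelyRegularIn_of_cycloReal_le hΛ hAff (by omega)
  tfae_have 4 → 3 := cycloReal_le_of_hasAffinelyRegularIn hn
  tfae_finish

end UPoly

end

theorem theorem3p1 (Λ : Set ℂ) (hΛ : ¬ UPoly.Degenerate Λ) (hAff : UPoly.PropAff Λ) :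
    (∀ m : ℕ, Even m → 8 ≤ m →
      List.TFAE [
        UPoly.HasUPolygonIn Λ m,
        UPoly.HasAffinelyRegularUPolygon Λ m,
        UPoly.cycloReal (m / 2) ≤ UPoly.fieldk Λ,
        UPoly.HasAffinelyRegularIn Λ (Nat.lcm (m / 2) 2)]) ∧
    (UPoly.PropAlg Λ →
      {m : ℕ | Even m ∧ 8 ≤ m ∧
        (UPoly.HasUPolygonIn Λ m ∨
          UPoly.HasAffinelyRegularUPolygon Λ m ∨
          UPoly.cycloReal (m / 2) ≤ UPoly.fieldk Λ ∨
          UPoly.HasAffinelyRegularIn Λ (Nat.lcm (m / 2) 2))}.Finite) := by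
  have key : ∀ m : ℕ, Even m → 8 ≤ m →
      List.TFAE [
        UPoly.HasUPolygonIn Λ m,
        UPoly.HasAffinelyRegularUPolygon Λ m,
        UPoly.cycloReal (m / 2) ≤ UPoly.fieldk Λ,
        UPoly.HasAffinelyRegularIn Λ (Nat.lcm (m / 2) 2)] := by
    rintro _ ⟨n, rfl⟩ hm
    rw [show (n + n) / 2 = n by omega]
    exact UPoly.tfae_of_four_le hΛ hAff (by omega)
  -- By the totient bound, `m / 2` divides `(2C)!` with `C = 2 [K : ℚ]`, so `m` is at most twice
  -- that factorial.
  refine ⟨key, fun hAlg => (Set.finite_Iic (2 *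
    (2 * (Module.finrank ℚ (UPoly.fieldK Λ) * 2)).factorial)).subset ?_⟩
  rintro m ⟨heven, hm, h⟩
  have htfae := key m heven hm
  have h3 : UPoly.cycloReal (m / 2) ≤ UPoly.fieldk Λ := by
    rcases h with h | h | h | h
    · exact (htfae.out 0 2).mp h
    · exact (htfae.out 1 2).mp h
    · exact h
    · exact (htfae.out 3 2).mp h
  have hdvd := UPoly.dvd_factorial_of_totient_le (by omega)
    (UPoly.totient_le_of_cycloReal_le hAlg (by omega) h3)
  have hle := Nat.le_of_dvd (Nat.factorial_pos _) hdvd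
  have htwo := Nat.div_two_mul_two_of_even heven
  simp only [Set.mem_Iic]
  omega
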